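/- Let $\{x_{ij} : i\le j\}$ be a (single, infinite) family of real random variables on a probability space, used for all $n$, and let $W_n$ be the $n\times n$ symmetric Wigner matrix with $(i,j)$ entry $x_{\min(i,j),\max(i,j)}$. Let $S_n$ be the $n\times n$ matrix with entries $0$ on the diagonal, $1$ above it and $-1$ below it, and let $\widetilde W_n=S_n\odot W_n$ be the entrywise product. For a real skew-symmetric $n\times n$ matrix $A$ with eigenvalues $\lambda_1,\dots,\lambda_n$ (counted with multiplicity; all are purely imaginary), define its empirical spectral distribution function by $$F^{A}(t)=\frac1n\,\#\{1\le j\le n:\ i\lambda_j\le t\},\qquad t\in\mathbb R .$$ Suppose that one of the following holds: (A1) the $x_{ij}$ are independent and uniformly bounded, with mean $0$ and variance $1$; (A2) the $x_{ij}$ are i.i.d. with mean $0$ and variance $1$; (A3) the $x_{ij}$ are independent with mean $0$ and variance $1$, and $\sup_{i\le j}\mathbb E|x_{ij}|^r<\infty$ for every $r\in\mathbb N$. Then, almost surely, $F^{n^{-1/2}\widetilde W_n}$ converges weakly, as $n\to\infty$, to the semicircle law with density $\frac1{2\pi}\sqrt{4-x^2}$ on $[-2,2]$; that is, outside a null set,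 $F^{n^{-1/2}\widetilde W_n}(t)\to F(t)$ at every continuity point $t$ of the distribution function $F$ of this law. Moreover, the following holds. Call a word of length $2k$ a Catalan word if $k=1$ and it is a double letter $aa$, or if $k>1$, every letter occurs in it exactly twice, and it contains a double letter whose deletion leaves a Catalan word of length $2k-2$. Let $w=w_1\cdots w_{2k}$ be a Catalan word and let $\pi:\{0,\dots,2k\}\to\{1,\dots,n\}$ satisfy $\pi(0)=\pi(2k)$ and $\{\pi(i-1),\pi(i)\}=\{\pi(j-1),\pi(j)\}$ whenever $w_i=w_j$. Then $\prod_{j=1}^{2k}(S_n)_{\pi(j-1),\pi(j)}$ equals $(-1)^k$ if $\pi(j-1)\ne\pi(j)$ for all $j$, and equals $0$ otherwise. -/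

import Mathlib

open MeasureTheory ProbabilityTheory Filter Topology

noncomputable section

namespace SkewWigner

/-! ### The skew-symmetric Wigner matrix -/

/-- Index set `{(i, j) : i ≤ j}` of the input variables of the Wigner matrix. -/
abbrev InputIndex : Type := {p : ℕ × ℕ // p.1 ≤ p.2}

/-- The Wigner link function `L(i, j) = (min i j, max i j)`. -/
def wignerLink (i j : ℕ) : InputIndex :=
  ⟨(min i j, max i j), le_trans (min_le_left i j) (le_max_left i j)⟩

/-- The symmetric Wigner matrix `W_n` (not normalized) with entries `x_{L(i,j)}`, at the outcome
`ω`. The rows and columns are numbered from `0`. -/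
def wigner {Ω : Type*} (x : InputIndex → Ω → ℝ) (n : ℕ) (ω : Ω) : Matrix (Fin n) (Fin n) ℝ :=
  Matrix.of fun i j => x (wignerLink i j) ω

/-- The sign matrix `S_n`: `0` on the diagonal, `1` above it, `-1` below it. -/
def signMatrix (n : ℕ) : Matrix (Fin n) (Fin n) ℝ :=
  Matrix.of fun i j => if i = j then 0 else if j < i then -1 else 1

/-- The skew-symmetric Wigner matrix, the entrywise product of `S_n` and `W_n`. -/
def skewWigner {Ω : Type*} (x : InputIndex → Ω → ℝ) (n : ℕ) (ω : Ω) :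
    Matrix (Fin n) (Fin n) ℝ :=
  Matrix.hadamard (signMatrix n) (wigner x n ω)

/-! ### Assumptions on the input variables -/

/-- Random variables which are independent with mean `0` and variance `1`. -/
structure IndepStandardized {ι Ω : Type*} [MeasurableSpace Ω] (x : ι → Ω → ℝ) (P : Measure Ω) :
    Prop where
  measurable : ∀ p, Measurable (x p)
  indep : iIndepFun x P
  memLp : ∀ p, MemLp (x p) 2 P
  mean : ∀ p, ∫ ω, x p ω ∂P = 0
  variance : ∀ p, Var[x p; P] = 1

/-- (A1): independent, uniformly bounded, mean `0` and variance `1`. -/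
def AssumptionA1 {ι Ω : Type*} [MeasurableSpace Ω] (x : ι → Ω → ℝ) (P : Measure Ω) : Prop :=
  IndepStandardized x P ∧ ∃ C : ℝ, ∀ p, ∀ᵐ ω ∂P, |x p ω| ≤ C

/-- (A2): i.i.d. with mean `0` and variance `1`. -/
def AssumptionA2 {ι Ω : Type*} [MeasurableSpace Ω] (x : ι → Ω → ℝ) (P : Measure Ω) : Prop :=
  IndepStandardized x P ∧ ∀ p q, IdentDistrib (x p) (x q) P P

/-- (A3): independent, mean `0` and variance `1`, and for each order the moments are bounded
uniformly over the family. -/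
def AssumptionA3 {ι Ω : Type*} [MeasurableSpace Ω] (x : ι → Ω → ℝ) (P : Measure Ω) : Prop :=
  IndepStandardized x P ∧
    ∀ r : ℕ, ∃ C : ℝ, ∀ p, Integrable (fun ω => |x p ω| ^ r) P ∧ ∫ ω, |x p ω| ^ r ∂P ≤ C

/-! ### Empirical spectral distribution and its limit -/

/-- The eigenvalues in `ℂ` of a real square matrix, with algebraic multiplicity. -/
def eigenvalues {n : ℕ} (A : Matrix (Fin n) (Fin n) ℝ) : Multiset ℂ :=
  (A.map (fun r : ℝ => (r : ℂ))).charpoly.roots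

/-- Empirical spectral distribution function of a real skew-symmetric `n × n` matrix with
eigenvalues `z₁, …, zₙ`: the value at `t` is `(1/n) #{j : i zⱼ ≤ t}`. The `zⱼ` are purely
imaginary, so that `i zⱼ` is the real number `(i zⱼ).re = -zⱼ.im`. -/
def esd {n : ℕ} (A : Matrix (Fin n) (Fin n) ℝ) (t : ℝ) : ℝ :=
  (1 / (n : ℝ)) * ((eigenvalues A).countP (fun z => (Complex.I * z).re ≤ t) : ℝ)

/-- The standard semicircle law, with density `√(4 - x²) / (2π)` on `[-2, 2]`. (The real square
root of a negative number is `0`.) -/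
def semicircleLaw : Measure ℝ :=
  volume.withDensity fun x => ENNReal.ofReal (Real.sqrt (4 - x ^ 2) / (2 * Real.pi))

/-- Random distribution functions `F n ω` converge weakly almost surely to `G`: outside a null
set, `F n ω t → G t` at all continuity points `t` of `G`. -/
def ConvergesWeaklyAS {Ω : Type*} [MeasurableSpace Ω] (P : Measure Ω) (F : ℕ → Ω → ℝ → ℝ)
    (G : ℝ → ℝ) : Prop :=
  ∀ᵐ ω ∂P, ∀ t : ℝ, ContinuousAt G t → Tendsto (fun n => F n ω t) atTop (𝓝 (G t))

/-! ### Circuits and Catalan words -/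

/-- Catalan words: a double letter `aa` is one, and a longer pair-matched word is one if deleting
some double letter `aa` from it leaves a Catalan word. -/
inductive IsCatalan : List ℕ → Prop
  | double (a : ℕ) : IsCatalan [a, a]
  | insert (u v : List ℕ) (a : ℕ) (ha : a ∉ u ++ v) (h : IsCatalan (u ++ v)) :
      IsCatalan (u ++ a :: a :: v)

/-- `π` is a circuit of length `h` on `n` vertices which belongs to `Π*(w)` for the Wigner link:
`π(0) = π(h)`, and steps of `π` at which `w` has the same letter have the same link value. -/
def MatchesWord {h n : ℕ} (w : Fin h → ℕ) (π : Fin (h + 1) → Fin n) : Prop :=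
  π 0 = π (Fin.last h) ∧
    ∀ i j : Fin h, w i = w j →
      wignerLink (π i.castSucc) (π i.succ) = wignerLink (π j.castSucc) (π j.succ)

/-- No step of the circuit stays at the same vertex. -/
def Loopless {h n : ℕ} (π : Fin (h + 1) → Fin n) : Prop :=
  ∀ j : Fin h, π j.castSucc ≠ π j.succ

/-- The sign `s_π` of a circuit, the product of the entries of `S_n` along its steps. -/
def circuitSign {h n : ℕ} (π : Fin (h + 1) → Fin n) : ℝ :=
  ∏ j : Fin h, signMatrix n (π j.castSucc) (π j.succ)

end SkewWigner

end

/-!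
# The semicircle law for skew-symmetric Wigner matrices

The matrix `H = i W̃ₙ` is Hermitian, with entries `± i x` above the diagonal and their conjugates
below it, and the empirical spectral distribution of `n^{-1/2} W̃ₙ` is that of `n^{-1/2} H`. The
proof works with its Stieltjes transform `sₙ(z) = n^{-1/2} tr R`, where `R = (H - ζ)⁻¹` and
`ζ = √n z` (`stieltjes`), rather than with moments. This treats the three assumptions at once and
needs no truncation: all that is used of them is that the squares of the variables are uniformly
integrable (`UniformlySquareIntegrable`).

* *Self-consistent equation in mean.* Take the trace of `H R = 1 + ζ R`, and expand `R` in
  `Hᵢⱼ Rⱼᵢ` around the resolvent of the matrix in which the variable at `(i, j)` is replaced by `0`.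
  That matrix is independent of the variable, and `Hᵢⱼ² = -x²`, `Hᵢⱼ Hⱼᵢ = x²`, so that
  `E[Hᵢⱼ Rⱼᵢ] ≈ E[Rⱼᵢ²] - E[Rᵢᵢ Rⱼⱼ]` (`IndepStandardized.norm_integral_entry_le`). Ward's identity
  makes the sum of the squares `Rⱼᵢ²` negligible, and `1 + z sₙ + sₙ²` tends to `0` in mean.
* *Concentration.* An inequality of Efron–Stein type (`variance_le_sum_update_zero`) bounds the
  variance of `sₙ` by a multiple of `1/n`. Therefore `E sₙ` satisfies the equation in the limit, and
  since the equation has only one root in the upper half plane, `E sₙ` converges to this root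
  (`tendsto_of_tendsto_quadratic`). The variances are summable along `n = k²`, which gives almost
  sure convergence along the squares. Removing a row and the corresponding column changes the trace
  of the resolvent by at most `1 / Im ζ`, for arbitrary entries, and this bridges the gaps between
  the squares (`norm_stieltjes_sub_le`).
* *Identification of the limit.* The root is the Stieltjes transform of the semicircle law
  (`integral_semicircleLaw_inv_sub`), and convergence of Stieltjes transforms implies convergence of
  distribution functions (`tendsto_real_Iic_of_stieltjes`).

The assertion about circuits is an induction on Catalan words: on a loopless path a double letter is
an edge which is traversed forth and back, it contributes `S_{ab} S_{ba} = -1`, and deleting the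
letter deletes these two steps (`IsCatalan.prod_sgn`).
-/

noncomputable section

namespace SkewWigner

/-! ### Signs of circuits along Catalan words -/

/-- The entry of the sign matrix at a pair of natural numbers. -/
def sgn (a b : ℕ) : ℝ := if a = b then 0 else if b < a then -1 else 1

lemma signMatrix_apply {n : ℕ} (i j : Fin n) : signMatrix n i j = sgn i j := by
  simp [signMatrix, sgn, Fin.ext_iff]

lemma sgn_mul_sgn_swap {a b : ℕ} (h : a ≠ b) : sgn a b * sgn b a = -1 := by
  unfold sgn
  rcases lt_or_gt_of_ne h with h' | h'
  · simp [h, h.symm, h', h'.not_gt]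
  · simp [h, h.symm, h', h'.not_gt]

lemma eq_of_wignerLink_eq {a b c : ℕ} (hab : a ≠ b) (h : wignerLink a b = wignerLink b c) :
    c = a := by
  have h1 : min a b = min b c := congrArg (fun p : InputIndex => p.1.1) h
  have h2 : max a b = max b c := congrArg (fun p : InputIndex => p.1.2) h
  have := hab
  omega

/-- A double letter forces a loopless path to go along an edge and straight back, which
contributes the factor `-1`; what is left is a path for the shorter word. The path need not be
assumed closed. -/
lemma IsCatalan.prod_sgn {w : List ℕ} (hw : IsCatalan w) (π : ℕ → ℕ)
    (hπ : ∀ i j, i < w.length → j < w.length → w[i]? = w[j]? →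
      wignerLink (π i) (π (i + 1)) = wignerLink (π j) (π (j + 1)))
    (hl : ∀ i < w.length, π i ≠ π (i + 1)) :
    ∏ i ∈ Finset.range w.length, sgn (π i) (π (i + 1)) = (-1) ^ (w.length / 2) := by
  induction hw generalizing π with
  | double a =>
    have h2 : π 2 = π 0 :=
      eq_of_wignerLink_eq (hl 0 (by simp)) (hπ 0 1 (by simp) (by simp) (by simp))
    simp [Finset.prod_range_succ, h2, sgn_mul_sgn_swap (hl 0 (by simp))]
  | insert u v a ha h ih =>
    set m := u.length with hm
    have hlen : (u ++ a :: a :: v).length = m + v.length + 2 := by simp [hm]; ring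
    have hback : π (m + 2) = π m := by
      refine eq_of_wignerLink_eq (hl m (by omega)) (hπ m (m + 1) (by omega) (by omega) ?_)
      simp [hm]
    let π' : ℕ → ℕ := fun j => if j ≤ m then π j else π (j + 2)
    have hge : ∀ j, m ≤ j → π' j = π (j + 2) := by
      intro j hj
      rcases hj.eq_or_lt with rfl | hj
      · simp [π', hback]
      · simp [π', hj.not_ge]
    have hle : ∀ j, j ≤ m → π' j = π j := fun j hj => by simp [π', hj]
    -- Step `j` of the shortened path is step `σ j` of the original one.
    let σ : ℕ → ℕ := fun j => if j < m then j else j + 2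
    have hσ : ∀ j, π' j = π (σ j) ∧ π' (j + 1) = π (σ j + 1) := by
      intro j
      by_cases hj : j < m
      · simp only [σ, hj, if_true]
        exact ⟨hle j hj.le, hle (j + 1) hj⟩
      · simp only [σ, hj, if_false]
        exact ⟨hge j (by omega), hge (j + 1) (by omega)⟩
    have hσw : ∀ j, (u ++ a :: a :: v)[σ j]? = (u ++ v)[j]? := by
      intro j
      by_cases hj : j < m
      · simp [σ, hj, List.getElem?_append, ← hm]
      · have h1 : ¬ j + 2 < m := by omega
        have h2 : j + 2 - m = (j - m) + 1 + 1 := by omega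
        simp [σ, hj, List.getElem?_append, ← hm, h1, h2]
    have hσlt : ∀ j, j < (u ++ v).length → σ j < (u ++ a :: a :: v).length := by
      intro j hj
      rw [List.length_append] at hj
      rw [hlen]
      simp only [σ]
      split_ifs <;> omega
    have key := ih π'
      (fun i j hi hj hij => by
        rw [(hσ i).1, (hσ i).2, (hσ j).1, (hσ j).2]
        exact hπ _ _ (hσlt i hi) (hσlt j hj) (by rw [hσw, hσw, hij]))
      (fun i hi => by
        rw [(hσ i).1, (hσ i).2]
        exact hl _ (hσlt i hi))
    rw [List.length_append, ← hm, Finset.prod_range_add] at key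
    rw [hlen, show m + v.length + 2 = m + (2 + v.length) by ring, Finset.prod_range_add,
      Finset.prod_range_add]
    have e1 : ∏ i ∈ Finset.range m, sgn (π' i) (π' (i + 1)) =
        ∏ i ∈ Finset.range m, sgn (π i) (π (i + 1)) :=
      Finset.prod_congr rfl fun i hi => by
        rw [hle i (Finset.mem_range.1 hi).le, hle (i + 1) (Finset.mem_range.1 hi)]
    have e2 : ∏ i ∈ Finset.range v.length, sgn (π' (m + i)) (π' (m + i + 1)) =
        ∏ i ∈ Finset.range v.length, sgn (π (m + (2 + i))) (π (m + (2 + i) + 1)) :=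
      Finset.prod_congr rfl fun i _ => by
        rw [hge _ (by omega), hge _ (by omega)]
        congr 2 <;> omega
    have e3 : ∏ i ∈ Finset.range 2, sgn (π (m + i)) (π (m + i + 1)) = -1 := by
      rw [Finset.prod_range_succ, Finset.prod_range_one]
      simp only [add_zero]
      rw [show m + 1 + 1 = m + 2 by ring, hback]
      exact sgn_mul_sgn_swap (hl m (by omega))
    rw [e1, e2] at key
    rw [e3, show (m + (2 + v.length)) / 2 = (m + v.length) / 2 + 1 by omega, pow_succ, ← key]
    ring

lemma circuitSign_of_loopless {k n : ℕ} {w : Fin (2 * k) → ℕ} (hw : IsCatalan (List.ofFn w))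
    {π : Fin (2 * k + 1) → Fin n} (hπ : MatchesWord w π) (hl : Loopless π) :
    circuitSign π = (-1) ^ k := by
  let ρ : ℕ → ℕ := fun i => if h : i < 2 * k + 1 then (π ⟨i, h⟩ : ℕ) else 0
  have hρ : ∀ i : Fin (2 * k), ρ i = π i.castSucc ∧ ρ (i + 1) = π i.succ := by
    intro i
    have h1 : (i : ℕ) < 2 * k + 1 := by omega
    have h2 : (i : ℕ) + 1 < 2 * k + 1 := by omega
    simp only [ρ, h1, h2, dif_pos]
    exact ⟨rfl, rfl⟩
  have h := hw.prod_sgn ρ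
    (fun i j hi hj hij => by
      rw [List.length_ofFn] at hi hj
      rw [(hρ ⟨i, hi⟩).1, (hρ ⟨i, hi⟩).2, (hρ ⟨j, hj⟩).1, (hρ ⟨j, hj⟩).2]
      refine hπ.2 ⟨i, hi⟩ ⟨j, hj⟩ ?_
      simpa [List.getElem?_ofFn, hi, hj] using hij)
    (fun i hi => by
      rw [List.length_ofFn] at hi
      rw [(hρ ⟨i, hi⟩).1, (hρ ⟨i, hi⟩).2]
      exact fun he => hl ⟨i, hi⟩ (Fin.ext he))
  rw [List.length_ofFn, Nat.mul_div_cancel_left k two_pos] at h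
  rw [← h, circuitSign, ← Fin.prod_univ_eq_prod_range (fun i => sgn (ρ i) (ρ (i + 1)))]
  refine Finset.prod_congr rfl fun i _ => ?_
  rw [signMatrix_apply, (hρ i).1, (hρ i).2]

lemma circuitSign_of_not_loopless {h n : ℕ} {π : Fin (h + 1) → Fin n} (hl : ¬ Loopless π) :
    circuitSign π = 0 := by
  simp only [Loopless, not_forall, not_not] at hl
  obtain ⟨j, hj⟩ := hl
  exact Finset.prod_eq_zero (Finset.mem_univ j) (by simp [signMatrix, hj])

/-! ### The Stieltjes transform of the semicircle law -/

/-- The solution in the upper half plane of the self-consistent equation of the semicircle law. -/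
lemma exists_root_im_pos {z : ℂ} (hz : 0 < z.im) : ∃ s : ℂ, 1 + z * s + s ^ 2 = 0 ∧ 0 < s.im := by
  obtain ⟨d, hd⟩ := IsAlgClosed.exists_pow_nat_eq (z ^ 2 - 4) two_pos
  set s := (-z + d) / 2 with hs
  have h : 1 + z * s + s ^ 2 = 0 := by
    rw [hs]
    linear_combination hd / 4
  have hs0 : s ≠ 0 := by
    intro h0
    simp [h0] at h
  have h' : 1 + z * s⁻¹ + s⁻¹ ^ 2 = 0 := by
    field_simp
    linear_combination h
  rcases lt_trichotomy s.im 0 with hi | hi | hi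
  · refine ⟨s⁻¹, h', ?_⟩
    rw [Complex.inv_im]
    exact div_pos (by linarith) (Complex.normSq_pos.2 hs0)
  · -- A real root is impossible, since `z = -(s + s⁻¹)` would be real.
    exfalso
    have h1 := congrArg Complex.im h
    simp [pow_two, hi] at h1
    rcases h1 with h1 | h1
    · exact hz.ne' h1
    · exact hs0 (Complex.ext h1 hi)
  · exact ⟨s, h, hi⟩

lemma norm_lt_one_of_root {z s : ℂ} (hz : 0 < z.im) (h : 1 + z * s + s ^ 2 = 0)
    (hs : 0 < s.im) : ‖s‖ < 1 := by
  have hs0 : s ≠ 0 := by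
    rintro rfl
    simp at hs
  have hzs : z = -(s + s⁻¹) := by
    field_simp
    linear_combination h
  have hN := Complex.normSq_pos.2 hs0
  have him : z.im = -(s.im - s.im / Complex.normSq s) := by
    rw [hzs]
    simp [Complex.inv_im, neg_div]
    ring
  have h1 : s.im < s.im / Complex.normSq s := by linarith
  rw [lt_div_iff₀ hN] at h1
  have h2 : Complex.normSq s < 1 := by nlinarith
  rw [Complex.normSq_eq_norm_sq] at h2
  nlinarith [norm_nonneg s]

/-- An approximate solution in the upper half plane is close to the exact one, because the second
root of the equation lies in the lower half plane. -/
lemma tendsto_of_tendsto_quadratic {ι : Type*} {l : Filter ι} {m : ι → ℂ} {z s : ℂ}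
    (hs : 1 + z * s + s ^ 2 = 0) (hsi : 0 < s.im) (hm : ∀ᶠ i in l, 0 < (m i).im)
    (h : Tendsto (fun i => 1 + z * m i + m i ^ 2) l (𝓝 0)) : Tendsto m l (𝓝 s) := by
  have hs0 : s ≠ 0 := by
    rintro rfl
    simp at hsi
  have hN := Complex.normSq_pos.2 hs0
  set c := s.im / Complex.normSq s with hc
  have hcpos : 0 < c := div_pos hsi hN
  have hci : (s⁻¹).im = -c := by rw [Complex.inv_im, hc, neg_div]
  have key : ∀ᶠ i in l, ‖m i - s‖ ≤ c⁻¹ * ‖1 + z * m i + m i ^ 2‖ := by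
    filter_upwards [hm] with i hi
    have e : 1 + z * m i + m i ^ 2 = (m i - s) * (m i - s⁻¹) := by
      field_simp
      linear_combination (m i) * hs
    have h1 : c ≤ ‖m i - s⁻¹‖ := by
      refine le_trans ?_ (Complex.abs_im_le_norm _)
      rw [Complex.sub_im, hci]
      exact le_trans (by linarith) (le_abs_self _)
    rw [e, norm_mul]
    rw [inv_mul_eq_div, le_div_iff₀ hcpos]
    exact mul_le_mul_of_nonneg_left h1 (norm_nonneg _)
  rw [tendsto_iff_norm_sub_tendsto_zero]
  refine squeeze_zero' (Eventually.of_forall fun _ => norm_nonneg _) key ?_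
  simpa using h.norm.const_mul c⁻¹

/-- Integration against the semicircle law in the variable `x = 2 cos θ`. -/
lemma integral_semicircleLaw (f : ℝ → ℂ) (hf : Continuous f) :
    ∫ x, f x ∂semicircleLaw =
      (Real.pi : ℂ)⁻¹ * ∫ θ in (0 : ℝ)..2 * Real.pi, (Real.sin θ : ℂ) ^ 2 * f (2 * Real.cos θ) := by
  have hpi := Real.pi_pos
  have hm : Measurable fun x : ℝ => Real.sqrt (4 - x ^ 2) / (2 * Real.pi) := by fun_prop
  set g : ℝ → ℂ := fun x => ((Real.sqrt (4 - x ^ 2) / (2 * Real.pi) : ℝ) : ℂ) * f x with hg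
  have hgc : Continuous g := by fun_prop
  have h1 : ∫ x, f x ∂semicircleLaw = ∫ x, g x := by
    rw [semicircleLaw, integral_withDensity_eq_integral_toReal_smul (by fun_prop) (by simp)]
    refine integral_congr_ae (Eventually.of_forall fun x => ?_)
    simp only [hg]
    rw [ENNReal.toReal_ofReal (by positivity), Complex.real_smul]
  have h2 : ∫ x, g x = ∫ x in (-2 : ℝ)..2, g x := by
    rw [intervalIntegral.integral_of_le (by norm_num), ← integral_Icc_eq_integral_Ioc,
      setIntegral_eq_integral_of_forall_compl_eq_zero]
    intro x hx
    have : 4 - x ^ 2 ≤ 0 := by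
      by_contra! hlt
      exact hx (abs_le.1 (abs_le_of_sq_le_sq (by linarith) (by norm_num)))
    simp [hg, Real.sqrt_eq_zero_of_nonpos this]
  set k : ℝ → ℂ := fun θ => (Real.sin θ : ℂ) ^ 2 * f (2 * Real.cos θ) with hk
  have hkc : Continuous k := by fun_prop
  have h3 : ∫ x in (-2 : ℝ)..2, g x = 2 * (Real.pi : ℂ)⁻¹ * ∫ θ in (0 : ℝ)..Real.pi, k θ := by
    have hsub := intervalIntegral.integral_deriv_smul_comp (a := 0) (b := Real.pi)
      (f := fun θ => 2 * Real.cos θ) (f' := fun θ => 2 * -Real.sin θ) (g := g)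
      (fun θ _ => (Real.hasDerivAt_cos θ).const_mul 2) (by fun_prop) hgc
    simp only [Real.cos_zero, Real.cos_pi, mul_one, mul_neg] at hsub
    rw [intervalIntegral.integral_symm, ← hsub, ← intervalIntegral.integral_neg,
      ← intervalIntegral.integral_const_mul]
    refine intervalIntegral.integral_congr fun θ hθ => ?_
    rw [Set.uIcc_of_le hpi.le] at hθ
    have hs := Real.sin_nonneg_of_nonneg_of_le_pi hθ.1 hθ.2
    have hsq : Real.sqrt (4 - (2 * Real.cos θ) ^ 2) = 2 * Real.sin θ := by
      rw [show 4 - (2 * Real.cos θ) ^ 2 = (2 * Real.sin θ) ^ 2 by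
        nlinarith [Real.sin_sq_add_cos_sq θ]]
      exact Real.sqrt_sq (by linarith)
    simp only [hg, hk, Function.comp, hsq, Complex.real_smul]
    push_cast
    have : (Real.pi : ℂ) ≠ 0 := by exact_mod_cast hpi.ne'
    field_simp
  have h4 : ∫ θ in (0 : ℝ)..2 * Real.pi, k θ = 2 * ∫ θ in (0 : ℝ)..Real.pi, k θ := by
    have hrefl : ∫ θ in Real.pi..2 * Real.pi, k θ = ∫ θ in (0 : ℝ)..Real.pi, k θ := by
      have h := intervalIntegral.integral_comp_sub_left (a := 0) (b := Real.pi) k (2 * Real.pi)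
      rw [show 2 * Real.pi - Real.pi = Real.pi by ring, sub_zero] at h
      rw [← h]
      refine intervalIntegral.integral_congr fun θ _ => ?_
      simp only [hk, Real.sin_two_pi_sub, Real.cos_two_pi_sub]
      push_cast
      ring
    rw [← intervalIntegral.integral_add_adjacent_intervals (b := Real.pi)
      (hkc.intervalIntegrable _ _) (hkc.intervalIntegrable _ _), hrefl]
    ring
  rw [h1, h2, h3, h4]
  ring

instance : IsProbabilityMeasure semicircleLaw := by
  have h1 : ∫ x in (-2 : ℝ)..2, Real.sqrt (4 - x ^ 2) / (2 * Real.pi) = 1 := by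
    have h := intervalIntegral.integral_comp_mul_left (a := -1) (b := 1)
      (fun x : ℝ => Real.sqrt (4 - x ^ 2) / (2 * Real.pi)) (c := 2) two_ne_zero
    have h' : ∀ x : ℝ, Real.sqrt (4 - (2 * x) ^ 2) = 2 * Real.sqrt (1 - x ^ 2) := by
      intro x
      rw [show 4 - (2 * x) ^ 2 = 2 ^ 2 * (1 - x ^ 2) by ring, Real.sqrt_mul (by norm_num),
        Real.sqrt_sq (by norm_num)]
    simp only [h', intervalIntegral.integral_div, intervalIntegral.integral_const_mul,
      integral_sqrt_one_sub_sq] at h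
    norm_num at h
    rw [intervalIntegral.integral_div]
    have := Real.pi_pos
    field_simp at h ⊢
    linarith
  have h0 : ∀ x : ℝ, 0 ≤ Real.sqrt (4 - x ^ 2) / (2 * Real.pi) := fun x => by positivity
  have hint : IntegrableOn (fun x : ℝ => Real.sqrt (4 - x ^ 2) / (2 * Real.pi)) (Set.Ioc (-2) 2) :=
    ((by fun_prop : Continuous fun x : ℝ => Real.sqrt (4 - x ^ 2) /
      (2 * Real.pi)).integrableOn_Icc).mono_set Set.Ioc_subset_Icc_self
  refine ⟨?_⟩
  rw [semicircleLaw, withDensity_apply _ MeasurableSet.univ, Measure.restrict_univ,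
    ← setLIntegral_eq_of_support_subset (s := Set.Ioc (-2 : ℝ) 2),
    ← ofReal_integral_eq_lintegral_ofReal hint (Eventually.of_forall h0),
    ← intervalIntegral.integral_of_le (by norm_num), h1, ENNReal.ofReal_one]
  intro x hx
  by_contra hnot
  refine hx ?_
  have : 4 - x ^ 2 ≤ 0 := by
    by_contra! hlt
    have h2 : x ≠ -2 := by
      rintro rfl
      norm_num at hlt
    have h3 := abs_le.1 (abs_le_of_sq_le_sq (by linarith : x ^ 2 ≤ 2 ^ 2) (by norm_num))
    exact hnot ⟨lt_of_le_of_ne h3.1 h2.symm, h3.2⟩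
  simp [Real.sqrt_eq_zero_of_nonpos this]

/-- The Stieltjes transform of the semicircle law at `z` is the root with positive imaginary part
of its self-consistent equation. With `z = -(s + s⁻¹)` and `x = 2 cos θ` the integrand splits into
a trigonometric polynomial and the two functions `(1 + s e^{±iθ})⁻¹`, which have mean `1`. -/
lemma integral_semicircleLaw_inv_sub {z s : ℂ} (hz : 0 < z.im) (h : 1 + z * s + s ^ 2 = 0)
    (hs : 0 < s.im) : ∫ x : ℝ, ((x : ℂ) - z)⁻¹ ∂semicircleLaw = s := by
  have hs1 := norm_lt_one_of_root hz h hs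
  have hs0 : s ≠ 0 := by
    rintro rfl
    simp at hs
  have hzs : z = -(s + s⁻¹) := by
    field_simp
    linear_combination h
  have hpi : (Real.pi : ℂ) ≠ 0 := by exact_mod_cast Real.pi_pos.ne'
  have hxz : ∀ x : ℝ, (x : ℂ) - z ≠ 0 := by
    intro x hx
    have := congrArg Complex.im hx
    simp at this
    exact hz.ne' this
  have hne : ∀ c w : ℂ, ‖c‖ < 1 → ‖w‖ ≤ 1 → 1 + c * w ≠ 0 := by
    intro c w hc hw h0
    have h1 : ‖c * w‖ = 1 := by
      rw [eq_neg_of_add_eq_zero_right h0]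
      simp
    rw [norm_mul] at h1
    nlinarith [norm_nonneg c, norm_nonneg w]
  let e : ℝ → ℂ := fun θ => Complex.exp (θ * Complex.I)
  have he1 : ∀ θ, ‖e θ‖ = 1 := fun θ => Complex.norm_exp_ofReal_mul_I θ
  have hec : Continuous e := by fun_prop
  have heinv : ∀ θ, (e θ)⁻¹ = e (-θ) := by
    intro θ
    simp only [e]
    rw [← Complex.exp_neg]
    congr 1
    push_cast
    ring
  -- The mean value property on the unit circle.
  have hmean : ∀ φ : ℂ → ℂ, DiffContOnCl ℂ φ (Metric.ball 0 1) →
      ∫ θ in (0 : ℝ)..2 * Real.pi, φ (e θ) = 2 * Real.pi * φ 0 := by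
    intro φ hφ
    have h1 := DiffContOnCl.circleAverage (f := φ) (c := 0) (R := 1) (by simpa using hφ)
    rw [Real.circleAverage_def] at h1
    have h2 : (fun θ : ℝ => φ (circleMap 0 1 θ)) = fun θ => φ (e θ) := by
      funext θ
      simp [e, circleMap]
    rw [h2, Complex.real_smul] at h1
    rw [← h1]
    push_cast
    field_simp
  have hsym : ∀ φ : ℂ → ℂ, ∫ θ in (0 : ℝ)..2 * Real.pi, φ (e θ)⁻¹ =
      ∫ θ in (0 : ℝ)..2 * Real.pi, φ (e θ) := by
    intro φ
    have h1 := intervalIntegral.integral_comp_sub_left (a := 0) (b := 2 * Real.pi)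
      (fun θ => φ (e θ)) (2 * Real.pi)
    rw [sub_self, sub_zero] at h1
    rw [← h1]
    refine intervalIntegral.integral_congr fun θ _ => ?_
    simp only [heinv]
    congr 1
    simp only [e]
    rw [show ((2 * Real.pi - θ : ℝ) : ℂ) * Complex.I = ((-θ : ℝ) : ℂ) * Complex.I +
      2 * Real.pi * Complex.I by push_cast; ring, Complex.exp_add, Complex.exp_two_pi_mul_I,
      mul_one]
  have hdu : DiffContOnCl ℂ (fun w : ℂ => (1 + s * w)⁻¹) (Metric.ball 0 1) := by
    refine DifferentiableOn.diffContOnCl fun w hw => ?_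
    rw [closure_ball _ one_ne_zero] at hw
    have hw' : ‖w‖ ≤ 1 := by simpa using hw
    exact DifferentiableAt.differentiableWithinAt
      (DifferentiableAt.inv (by fun_prop) (hne s w hs1 hw'))
  have hu := hmean _ hdu
  have hv := hsym fun w => (1 + s * w)⁻¹
  have hid := hmean (fun w => w) differentiable_id.diffContOnCl
  have hidv := hsym fun w => w
  simp only [mul_zero, add_zero, inv_one, mul_one] at hu hid
  rw [hu] at hv
  rw [hid] at hidv
  have hcont_inv : Continuous fun θ => (e θ)⁻¹ := by
    simp only [heinv]
    fun_prop
  have hcu : Continuous fun θ => (1 + s * e θ)⁻¹ :=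
    Continuous.inv₀ (by fun_prop) fun θ => hne s _ hs1 (he1 θ).le
  have hcv : Continuous fun θ => (1 + s * (e θ)⁻¹)⁻¹ :=
    Continuous.inv₀ (by fun_prop) fun θ => hne s _ hs1 (by rw [heinv, he1])
  rw [integral_semicircleLaw (fun x : ℝ => ((x : ℂ) - z)⁻¹) (Continuous.inv₀ (by fun_prop) hxz)]
  have hpt : ∀ θ : ℝ, (Real.sin θ : ℂ) ^ 2 * (((2 * Real.cos θ : ℝ) : ℂ) - z)⁻¹ =
      4⁻¹ * (s + s⁻¹ + (1 - s ^ 2) / s) - 4⁻¹ * e θ - 4⁻¹ * (e θ)⁻¹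
        - 4⁻¹ * ((1 - s ^ 2) / s) * (1 + s * e θ)⁻¹
        - 4⁻¹ * ((1 - s ^ 2) / s) * (1 + s * (e θ)⁻¹)⁻¹ := by
    intro θ
    have e0 : e θ ≠ 0 := Complex.exp_ne_zero _
    have h1 := hne s _ hs1 (he1 θ).le
    have h2 : 1 + s * (e θ)⁻¹ ≠ 0 := hne s _ hs1 (by rw [heinv, he1])
    have h3 := hxz (2 * Real.cos θ)
    have hcos : (Real.cos θ : ℂ) = (e θ + (e θ)⁻¹) / 2 := by
      rw [heinv]
      simp only [e]
      rw [Complex.ofReal_cos, Complex.cos]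
      push_cast
      ring_nf
    have hsin : (Real.sin θ : ℂ) ^ 2 = 1 - (Real.cos θ : ℂ) ^ 2 := by
      rw [eq_sub_iff_add_eq]
      exact_mod_cast Real.sin_sq_add_cos_sq θ
    have h4 : ((2 * Real.cos θ : ℝ) : ℂ) - z = (1 + s * e θ) * (1 + s * (e θ)⁻¹) / s := by
      rw [Complex.ofReal_mul, hcos, hzs]
      push_cast
      field_simp
      ring
    have h2' : e θ + s ≠ 0 := by
      intro h0
      apply h2
      field_simp
      rw [h0, mul_zero]
    rw [hsin, hcos, h4]
    generalize e θ = t at e0 h1 h2'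
    have h1' : 1 + t * s ≠ 0 := by rwa [mul_comm]
    field_simp
    ring
  simp only [hpt]
  rw [intervalIntegral.integral_sub, intervalIntegral.integral_sub, intervalIntegral.integral_sub,
    intervalIntegral.integral_sub, intervalIntegral.integral_const]
  · simp only [intervalIntegral.integral_const_mul, hu, hv, hid, hidv]
    rw [Complex.real_smul]
    push_cast
    field_simp
    ring
  all_goals exact Continuous.intervalIntegrable (by fun_prop) _ _

/-! ### From Stieltjes transforms to distribution functions -/

/-- The distribution function of the standard Cauchy law, used as a smooth substitute for the
indicator of a half-line. -/
def cauchyStep (u : ℝ) : ℝ := 1 / 2 + Real.arctan u / Real.pi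

lemma continuous_cauchyStep : Continuous cauchyStep := by
  unfold cauchyStep
  fun_prop

lemma cauchyStep_neg (u : ℝ) : cauchyStep (-u) = 1 - cauchyStep u := by
  simp only [cauchyStep, Real.arctan_neg]
  ring

lemma cauchyStep_mono : Monotone cauchyStep := fun u v h => by
  have := Real.arctan_strictMono.monotone h
  unfold cauchyStep
  gcongr

lemma cauchyStep_nonneg (u : ℝ) : 0 ≤ cauchyStep u := by
  have h := Real.neg_pi_div_two_lt_arctan u
  have hpi := Real.pi_pos
  have : -(1 / 2) ≤ Real.arctan u / Real.pi := by
    rw [le_div_iff₀ hpi]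
    linarith
  unfold cauchyStep
  linarith

lemma cauchyStep_le_one (u : ℝ) : cauchyStep u ≤ 1 := by
  have := cauchyStep_nonneg (-u)
  rw [cauchyStep_neg] at this
  linarith

lemma tendsto_cauchyStep_atTop : Tendsto cauchyStep atTop (𝓝 1) := by
  have h := (Real.tendsto_arctan_atTop.mono_right nhdsWithin_le_nhds).div_const Real.pi
  have h2 := h.const_add (1 / 2)
  have : 1 / 2 + Real.pi / 2 / Real.pi = 1 := by
    have := Real.pi_pos.ne'
    field_simp
    norm_num
  rwa [this] at h2

lemma tendsto_cauchyStep_atBot : Tendsto cauchyStep atBot (𝓝 0) := by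
  have h := (tendsto_cauchyStep_atTop.comp tendsto_neg_atBot_atTop).const_sub 1
  simp only [sub_self] at h
  refine h.congr fun u => ?_
  simp [cauchyStep_neg]

lemma integrable_cauchyStep (μ : Measure ℝ) [IsFiniteMeasure μ] {g : ℝ → ℝ} (hg : Continuous g) :
    Integrable (fun x => cauchyStep (g x)) μ :=
  .of_bound (continuous_cauchyStep.comp hg).aestronglyMeasurable 1 <| ae_of_all _ fun x => by
    rw [Real.norm_of_nonneg (cauchyStep_nonneg _)]
    exact cauchyStep_le_one _

lemma tendsto_integral_cauchyStep (μ : Measure ℝ) [IsFiniteMeasure μ] {ι : Type*} {l : Filter ι}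
    [l.IsCountablyGenerated] {g : ι → ℝ → ℝ} (hg : ∀ i, Continuous (g i)) {f : ℝ → ℝ}
    (h : ∀ᵐ x ∂μ, Tendsto (fun i => cauchyStep (g i x)) l (𝓝 (f x))) :
    Tendsto (fun i => ∫ x, cauchyStep (g i x) ∂μ) l (𝓝 (∫ x, f x ∂μ)) := by
  refine tendsto_integral_filter_of_dominated_convergence (fun _ => 1)
    (Eventually.of_forall fun i => (continuous_cauchyStep.comp (hg i)).aestronglyMeasurable)
    (Eventually.of_forall fun i => ae_of_all _ fun x => ?_) (integrable_const _) h
  rw [Real.norm_of_nonneg (cauchyStep_nonneg _)]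
  exact cauchyStep_le_one _

lemma sub_add_mul_I_ne_zero (x E : ℝ) {η : ℝ} (hη : 0 < η) : (x : ℂ) - (E + η * Complex.I) ≠ 0 := by
  intro h
  have := congrArg Complex.im h
  simp at this
  exact hη.ne' this

lemma norm_inv_sub_le (x : ℝ) {z : ℂ} (hz : 0 < z.im) : ‖((x : ℂ) - z)⁻¹‖ ≤ z.im⁻¹ := by
  rw [norm_inv]
  refine inv_anti₀ hz ?_
  have := Complex.abs_im_le_norm ((x : ℂ) - z)
  simp only [Complex.sub_im, Complex.ofReal_im, zero_sub, abs_neg, abs_of_pos hz] at this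
  exact this

lemma sub_ne_zero_of_im_pos (x : ℝ) {z : ℂ} (hz : 0 < z.im) : (x : ℂ) - z ≠ 0 := by
  intro h
  have := congrArg Complex.im h
  simp at this
  exact hz.ne' this

lemma integrable_inv_sub (μ : Measure ℝ) [IsFiniteMeasure μ] {z : ℂ} (hz : 0 < z.im) :
    Integrable (fun x : ℝ => ((x : ℂ) - z)⁻¹) μ :=
  .of_bound (Continuous.aestronglyMeasurable
    (Continuous.inv₀ (by fun_prop) fun x => sub_ne_zero_of_im_pos x hz)) _
    (ae_of_all _ fun x => norm_inv_sub_le x hz)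

/-- The Cauchy kernel is the imaginary part of `(x - (E + iη))⁻¹`, and its primitive in `E` is a
smoothed step. -/
lemma integral_im_inv_sub (x a b : ℝ) {η : ℝ} (hη : 0 < η) :
    ∫ E in a..b, (((x : ℂ) - (E + η * Complex.I))⁻¹).im =
      Real.pi * (cauchyStep (η⁻¹ * (b - x)) - cauchyStep (η⁻¹ * (a - x))) := by
  have hd : ∀ E ∈ Set.uIcc a b, HasDerivAt (fun E => Real.arctan (η⁻¹ * (E - x)))
      ((((x : ℂ) - (E + η * Complex.I))⁻¹).im) E := by
    intro E _
    have h := ((((hasDerivAt_id E).sub_const x).const_mul η⁻¹).arctan)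
    refine h.congr_deriv ?_
    have him : (((x : ℂ) - (E + η * Complex.I))⁻¹).im = η / ((x - E) ^ 2 + η ^ 2) := by
      rw [Complex.inv_im, Complex.normSq_apply]
      simp [pow_two]
    rw [him, id]
    have h1 : (x - E) ^ 2 + η ^ 2 ≠ 0 := by positivity
    have h2 : η ^ 2 + (E - x) ^ 2 ≠ 0 := by positivity
    field_simp
    ring
  rw [intervalIntegral.integral_eq_sub_of_hasDerivAt hd]
  · have := Real.pi_pos.ne'
    simp only [cauchyStep]
    field_simp
    ring
  · refine Continuous.intervalIntegrable ?_ _ _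
    exact Complex.continuous_im.comp
      (Continuous.inv₀ (by fun_prop) fun E => sub_add_mul_I_ne_zero x E hη)

lemma integral_im_stieltjes (μ : Measure ℝ) [IsFiniteMeasure μ] (a b : ℝ) (hab : a ≤ b) {η : ℝ}
    (hη : 0 < η) :
    ∫ E in a..b, (∫ x : ℝ, ((x : ℂ) - (E + η * Complex.I))⁻¹ ∂μ).im =
      Real.pi * (∫ x, cauchyStep (η⁻¹ * (b - x)) ∂μ - ∫ x, cauchyStep (η⁻¹ * (a - x)) ∂μ) := by
  rw [← integral_sub (integrable_cauchyStep μ (by fun_prop))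
    (integrable_cauchyStep μ (by fun_prop)), ← integral_const_mul]
  simp only [← integral_im_inv_sub _ a b hη]
  have hz : ∀ E : ℝ, 0 < ((E : ℂ) + η * Complex.I).im := fun E => by simpa using hη
  have h1 : ∀ E : ℝ, (∫ x : ℝ, ((x : ℂ) - (E + η * Complex.I))⁻¹ ∂μ).im =
      ∫ x : ℝ, (((x : ℂ) - (E + η * Complex.I))⁻¹).im ∂μ := fun E =>
    (integral_im (integrable_inv_sub μ (hz E))).symm
  simp only [h1, intervalIntegral.integral_of_le hab]
  refine integral_integral_swap ?_
  refine .of_bound (C := η⁻¹) (Continuous.aestronglyMeasurable ?_) (ae_of_all _ fun p => ?_)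
  · exact Complex.continuous_im.comp
      (Continuous.inv₀ (by fun_prop) fun p : ℝ × ℝ => sub_add_mul_I_ne_zero p.2 p.1 hη)
  · refine (Complex.abs_im_le_norm _).trans ?_
    simpa using norm_inv_sub_le p.2 (hz p.1)

lemma tendsto_integral_cauchyStep_sub {μ : ℕ → Measure ℝ} [∀ n, IsProbabilityMeasure (μ n)]
    {ν : Measure ℝ} [IsProbabilityMeasure ν]
    (h : ∀ z : ℂ, 0 < z.im → Tendsto (fun n => ∫ x : ℝ, ((x : ℂ) - z)⁻¹ ∂μ n) atTop
      (𝓝 (∫ x : ℝ, ((x : ℂ) - z)⁻¹ ∂ν))) {a b c : ℝ} (hab : a ≤ b) (hc : 0 < c) :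
    Tendsto (fun n => ∫ x, cauchyStep (c * (b - x)) ∂μ n - ∫ x, cauchyStep (c * (a - x)) ∂μ n)
      atTop (𝓝 (∫ x, cauchyStep (c * (b - x)) ∂ν - ∫ x, cauchyStep (c * (a - x)) ∂ν)) := by
  have hη : 0 < c⁻¹ := inv_pos.2 hc
  have hz : ∀ E : ℝ, 0 < ((E : ℂ) + (c⁻¹ : ℝ) * Complex.I).im := fun E => by simpa using hc
  have hcont : ∀ (ρ : Measure ℝ) [IsProbabilityMeasure ρ], Continuous fun E : ℝ =>
      (∫ x : ℝ, ((x : ℂ) - (E + (c⁻¹ : ℝ) * Complex.I))⁻¹ ∂ρ).im := by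
    intro ρ _
    refine Complex.continuous_im.comp (continuous_of_dominated (bound := fun _ => c)
      (fun E => (integrable_inv_sub ρ (hz E)).1) (fun E => ae_of_all _ fun x => ?_)
      (integrable_const _) (ae_of_all _ fun x =>
        Continuous.inv₀ (by fun_prop) fun E => sub_add_mul_I_ne_zero x E hη))
    simpa using norm_inv_sub_le x (hz E)
  have key : Tendsto
      (fun n => ∫ E in a..b, (∫ x : ℝ, ((x : ℂ) - (E + (c⁻¹ : ℝ) * Complex.I))⁻¹ ∂μ n).im) atTop
      (𝓝 (∫ E in a..b, (∫ x : ℝ, ((x : ℂ) - (E + (c⁻¹ : ℝ) * Complex.I))⁻¹ ∂ν).im)) := by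
    refine intervalIntegral.tendsto_integral_filter_of_dominated_convergence (fun _ => c)
      (Eventually.of_forall fun n => (hcont (μ n)).aestronglyMeasurable)
      (Eventually.of_forall fun n => ae_of_all _ fun E _ => ?_) (by simp)
      (ae_of_all _ fun E _ => ((Complex.continuous_im.tendsto _).comp (h _ (hz E))))
    refine (Complex.abs_im_le_norm _).trans ?_
    have := norm_integral_le_of_norm_le_const (μ := μ n)
      (ae_of_all _ fun x => norm_inv_sub_le x (hz E))
    simpa using this
  simp only [integral_im_stieltjes _ a b hab hη, inv_inv] at key
  have := key.const_mul Real.pi⁻¹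
  simpa only [← mul_assoc, inv_mul_cancel₀ Real.pi_pos.ne', one_mul] using this

/-- No mass escapes to infinity, because the limit is a probability measure. -/
lemma tendsto_integral_cauchyStep_of_stieltjes {μ : ℕ → Measure ℝ}
    [∀ n, IsProbabilityMeasure (μ n)] {ν : Measure ℝ} [IsProbabilityMeasure ν]
    (h : ∀ z : ℂ, 0 < z.im → Tendsto (fun n => ∫ x : ℝ, ((x : ℂ) - z)⁻¹ ∂μ n) atTop
      (𝓝 (∫ x : ℝ, ((x : ℂ) - z)⁻¹ ∂ν))) (b : ℝ) {c : ℝ} (hc : 0 < c) :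
    Tendsto (fun n => ∫ x, cauchyStep (c * (b - x)) ∂μ n) atTop
      (𝓝 (∫ x, cauchyStep (c * (b - x)) ∂ν)) := by
  have hlim : ∀ x : ℝ, Tendsto (fun a : ℝ => c * (a - x)) atTop atTop := fun x =>
    (tendsto_atTop_add_const_right _ (-x) tendsto_id).const_mul_atTop hc
  have hlim' : ∀ x : ℝ, Tendsto (fun a : ℝ => c * (a - x)) atBot atBot := fun x =>
    (tendsto_atBot_add_const_right _ (-x) tendsto_id).const_mul_atBot hc
  have h1 : Tendsto (fun a : ℝ => ∫ x, cauchyStep (c * (a - x)) ∂ν) atTop (𝓝 1) := by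
    simpa using tendsto_integral_cauchyStep ν (f := fun _ => 1) (g := fun a x => c * (a - x))
      (fun a => by fun_prop) (ae_of_all _ fun x => tendsto_cauchyStep_atTop.comp (hlim x))
  have h0 : Tendsto (fun a : ℝ => ∫ x, cauchyStep (c * (a - x)) ∂ν) atBot (𝓝 0) := by
    simpa using tendsto_integral_cauchyStep ν (f := fun _ => 0) (g := fun a x => c * (a - x))
      (fun a => by fun_prop) (ae_of_all _ fun x => tendsto_cauchyStep_atBot.comp (hlim' x))
  rw [Metric.tendsto_nhds]
  intro ε hε
  obtain ⟨B, hB, hBb⟩ := ((h1.eventually (lt_mem_nhds (show 1 - ε / 2 < 1 by linarith))).and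
    (eventually_ge_atTop b)).exists
  obtain ⟨A, hA, hAb⟩ := ((h0.eventually (gt_mem_nhds (show 0 < ε / 2 by linarith))).and
    (eventually_le_atBot b)).exists
  filter_upwards [(Metric.tendsto_nhds.1 (tendsto_integral_cauchyStep_sub h hAb hc)) (ε / 2)
    (by linarith), (Metric.tendsto_nhds.1 (tendsto_integral_cauchyStep_sub h hBb hc)) (ε / 2)
    (by linarith)] with n hn1 hn2
  have e1 : 0 ≤ ∫ x, cauchyStep (c * (A - x)) ∂μ n :=
    integral_nonneg fun x => cauchyStep_nonneg _
  have e2 : ∫ x, cauchyStep (c * (B - x)) ∂μ n ≤ 1 := by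
    have := integral_mono (integrable_cauchyStep (μ n) (g := fun x => c * (B - x)) (by fun_prop))
      (integrable_const 1) (fun x => cauchyStep_le_one _)
    simpa using this
  rw [Real.dist_eq, abs_lt] at *
  constructor <;> linarith [hn1.1, hn1.2, hn2.1, hn2.2]

/-- Convergence of Stieltjes transforms on the upper half plane implies convergence of the
distribution functions at every point which is not an atom of the limit. -/
lemma tendsto_real_Iic_of_stieltjes {μ : ℕ → Measure ℝ} [∀ n, IsProbabilityMeasure (μ n)]
    {ν : Measure ℝ} [IsProbabilityMeasure ν]
    (h : ∀ z : ℂ, 0 < z.im → Tendsto (fun n => ∫ x : ℝ, ((x : ℂ) - z)⁻¹ ∂μ n) atTop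
      (𝓝 (∫ x : ℝ, ((x : ℂ) - z)⁻¹ ∂ν))) {t : ℝ} (ht : ν {t} = 0) :
    Tendsto (fun n => (μ n).real (Set.Iic t)) atTop (𝓝 (ν.real (Set.Iic t))) := by
  -- Steps located at `t ± 1/(m+1)` with width `1/(m+1)²`.
  let c : ℕ → ℝ := fun m => ((m : ℝ) + 1) ^ 2
  have hc : ∀ m, 0 < c m := fun m => by positivity
  let b : ℝ → ℕ → ℝ := fun σ m => t + σ / (m + 1)
  have harg : ∀ σ m x, c m * (b σ m - x) = ((m : ℝ) + 1) * ((t - x) * (m + 1) + σ) := by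
    intro σ m x
    have : (m : ℝ) + 1 ≠ 0 := by positivity
    simp only [c, b]
    field_simp
    ring
  let e : ℕ → ℝ := fun m => 1 - cauchyStep (m + 1)
  have hm : Tendsto (fun m : ℕ => (m : ℝ) + 1) atTop atTop :=
    tendsto_atTop_add_const_right _ _ tendsto_natCast_atTop_atTop
  have he : Tendsto e atTop (𝓝 0) := by
    simpa using (tendsto_cauchyStep_atTop.comp hm).const_sub 1
  have hν : ∀ σ : ℝ, Tendsto (fun m => ∫ x, cauchyStep (c m * (b σ m - x)) ∂ν) atTop
      (𝓝 (ν.real (Set.Iic t))) := by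
    intro σ
    rw [← integral_indicator_one measurableSet_Iic]
    refine tendsto_integral_cauchyStep ν (fun m => by fun_prop) ?_
    have hne : ∀ᵐ x ∂ν, x ≠ t := by
      rw [ae_iff]
      simpa using ht
    filter_upwards [hne] with x hx
    simp only [harg]
    rcases lt_or_gt_of_ne hx with hlt | hgt
    · rw [Set.indicator_of_mem (by simpa using hlt.le)]
      exact tendsto_cauchyStep_atTop.comp (hm.atTop_mul_atTop₀
        (tendsto_atTop_add_const_right _ _ (hm.const_mul_atTop (sub_pos.2 hlt))))
    · rw [Set.indicator_of_notMem (by simpa using hgt)]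
      exact tendsto_cauchyStep_atBot.comp (hm.atTop_mul_atBot₀
        (tendsto_atBot_add_const_right _ _ (hm.const_mul_atTop_of_neg (sub_neg.2 hgt))))
  have hup : ∀ m n, (μ n).real (Set.Iic t) ≤ ∫ x, cauchyStep (c m * (b 1 m - x)) ∂μ n + e m := by
    intro m n
    have hi := integrable_cauchyStep (μ n) (g := fun x => c m * (b 1 m - x)) (by fun_prop)
    rw [← integral_indicator_one measurableSet_Iic,
      show e m = ∫ _, e m ∂μ n by simp, ← integral_add hi (integrable_const _)]
    refine integral_mono ((integrable_const (1 : ℝ)).indicator measurableSet_Iic)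
      (hi.add (integrable_const _)) fun x => ?_
    have hmp : (0 : ℝ) < m + 1 := by positivity
    by_cases hx : x ≤ t
    · rw [Set.indicator_of_mem (by simpa using hx)]
      have : cauchyStep (m + 1) ≤ cauchyStep (c m * (b 1 m - x)) := by
        refine cauchyStep_mono ?_
        rw [harg]
        nlinarith [mul_nonneg (mul_nonneg hmp.le hmp.le) (sub_nonneg.2 hx)]
      simp only [Pi.one_apply, e]
      linarith
    · rw [Set.indicator_of_notMem (by simpa using hx)]
      simp only [e]
      linarith [cauchyStep_nonneg (c m * (b 1 m - x)), cauchyStep_le_one (m + 1)]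
  have hlow : ∀ m n,
      ∫ x, cauchyStep (c m * (b (-1) m - x)) ∂μ n ≤ (μ n).real (Set.Iic t) + e m := by
    intro m n
    have hi := integrable_cauchyStep (μ n) (g := fun x => c m * (b (-1) m - x)) (by fun_prop)
    have hI : Integrable ((Set.Iic t).indicator (1 : ℝ → ℝ)) (μ n) :=
      (integrable_const (1 : ℝ)).indicator measurableSet_Iic
    rw [← integral_indicator_one measurableSet_Iic,
      show e m = ∫ _, e m ∂μ n by simp, ← integral_add hI (integrable_const _)]
    refine integral_mono hi (hI.add (integrable_const _)) fun x => ?_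
    have hmp : (0 : ℝ) < m + 1 := by positivity
    by_cases hx : x ≤ t
    · rw [Set.indicator_of_mem (by simpa using hx)]
      simp only [Pi.one_apply, e]
      linarith [cauchyStep_le_one (c m * (b (-1) m - x)), cauchyStep_le_one (m + 1)]
    · rw [Set.indicator_of_notMem (by simpa using hx)]
      have : cauchyStep (c m * (b (-1) m - x)) ≤ cauchyStep (-(m + 1)) := by
        refine cauchyStep_mono ?_
        rw [harg]
        nlinarith [mul_nonneg (mul_nonneg hmp.le hmp.le) (sub_nonneg.2 (not_le.1 hx).le)]
      rw [cauchyStep_neg] at this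
      simp only [e]
      linarith
  rw [Metric.tendsto_nhds]
  intro ε hε
  obtain ⟨m, h1, h2, h3⟩ := ((Metric.tendsto_nhds.1 (hν 1) (ε / 3) (by linarith)).and
    ((Metric.tendsto_nhds.1 (hν (-1)) (ε / 3) (by linarith)).and
      (Metric.tendsto_nhds.1 he (ε / 3) (by linarith)))).exists
  filter_upwards [Metric.tendsto_nhds.1
    (tendsto_integral_cauchyStep_of_stieltjes h (b 1 m) (hc m)) (ε / 3) (by linarith),
    Metric.tendsto_nhds.1
    (tendsto_integral_cauchyStep_of_stieltjes h (b (-1) m) (hc m)) (ε / 3) (by linarith)]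
    with n hn1 hn2
  have hu := hup m n
  have hl := hlow m n
  rw [Real.dist_eq, abs_lt] at *
  constructor <;> linarith [h1.1, h1.2, h2.1, h2.2, h3.1, h3.2, hn1.1, hn1.2, hn2.1, hn2.2]

/-! ### Resolvents of Hermitian matrices -/

lemma conjTranspose_sub_smul_one {ι : Type*} [DecidableEq ι] {H : Matrix ι ι ℂ} {ζ : ℂ}
    (hH : H.IsHermitian) :
    (H - ζ • 1).conjTranspose = H - (starRingEnd ℂ ζ) • 1 := by
  rw [Matrix.conjTranspose_sub, hH.eq, Matrix.conjTranspose_smul, Matrix.conjTranspose_one]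
  rfl

lemma sub_conj_smul_one {ι : Type*} [DecidableEq ι] {ζ : ℂ} :
    ((starRingEnd ℂ ζ) • (1 : Matrix ι ι ℂ)) =
    ζ • 1 - (2 * ζ.im * Complex.I) • 1 := by
  rw [← sub_smul]
  congr 1
  apply Complex.ext <;> simp
  ring

/-- Cauchy–Schwarz inequality for finite sums of complex numbers. -/
lemma norm_sum_mul_le {ι : Type*} [Fintype ι] {a b : ι → ℂ} {A B c : ℝ}
    (ha : ∑ k, ‖a k‖ ^ 2 ≤ A) (hb : ∑ k, ‖b k‖ ^ 2 ≤ B) (hAB : A * B ≤ c ^ 2) (hc : 0 ≤ c) :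
    ‖∑ k, a k * b k‖ ≤ c := by
  refine (norm_sum_le _ _).trans ?_
  simp only [norm_mul]
  have h := Finset.sum_mul_sq_le_sq_mul_sq Finset.univ (fun k => ‖a k‖) (fun k => ‖b k‖)
  have h0 : 0 ≤ ∑ k, ‖b k‖ ^ 2 := Finset.sum_nonneg fun _ _ => by positivity
  have h1 : 0 ≤ ∑ k, ‖a k‖ ^ 2 := Finset.sum_nonneg fun _ _ => by positivity
  exact le_of_sq_le_sq (h.trans ((mul_le_mul ha hb h0 (h1.trans ha)).trans hAB)) hc

section Resolvent

variable {ι : Type*} [Fintype ι] [DecidableEq ι]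

/-- The resolvent `(H - ζ)⁻¹`. -/
def res (H : Matrix ι ι ℂ) (ζ : ℂ) : Matrix ι ι ℂ := (H - ζ • 1)⁻¹

variable {H H' : Matrix ι ι ℂ} {ζ ζ' : ℂ}

lemma det_sub_smul_one_ne_zero (hH : H.IsHermitian) (hζ : 0 < ζ.im) : (H - ζ • 1).det ≠ 0 := by
  have h1 := H.eval_charpoly ζ
  rw [hH.charpoly_eq, Polynomial.eval_prod] at h1
  have h2 : H - ζ • 1 = -(Matrix.scalar ι ζ - H) := by
    rw [neg_sub, Matrix.scalar_apply, ← Matrix.smul_one_eq_diagonal]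
  rw [h2, Matrix.det_neg, ← h1]
  refine mul_ne_zero (by simp) (Finset.prod_ne_zero_iff.2 fun i _ => ?_)
  simp only [Polynomial.eval_sub, Polynomial.eval_X, Polynomial.eval_C]
  intro h0
  have := congrArg Complex.im h0
  simp at this
  exact hζ.ne' this

lemma mul_res (hH : H.IsHermitian) (hζ : 0 < ζ.im) : (H - ζ • 1) * res H ζ = 1 :=
  Matrix.mul_nonsing_inv _ (isUnit_iff_ne_zero.2 (det_sub_smul_one_ne_zero hH hζ))

lemma res_mul (hH : H.IsHermitian) (hζ : 0 < ζ.im) : res H ζ * (H - ζ • 1) = 1 :=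
  Matrix.nonsing_inv_mul _ (isUnit_iff_ne_zero.2 (det_sub_smul_one_ne_zero hH hζ))

/-- Second resolvent identity. -/
lemma res_sub_res (hH : H.IsHermitian) (hH' : H'.IsHermitian) (hζ : 0 < ζ.im) :
    res H' ζ - res H ζ = res H' ζ * (H - H') * res H ζ := by
  have h : H - H' = (H - ζ • 1) - (H' - ζ • 1) := by abel
  rw [h, mul_sub, sub_mul, mul_assoc, mul_res hH hζ, res_mul hH' hζ, mul_one, one_mul]

/-- First resolvent identity. -/
lemma res_sub_res_of_im_pos (hH : H.IsHermitian) (hζ : 0 < ζ.im) (hζ' : 0 < ζ'.im) :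
    res H ζ - res H ζ' = (ζ - ζ') • (res H ζ * res H ζ') := by
  have h : (ζ - ζ') • (1 : Matrix ι ι ℂ) = (H - ζ' • 1) - (H - ζ • 1) := by
    rw [sub_smul]
    abel
  calc res H ζ - res H ζ' = res H ζ * ((H - ζ' • 1) - (H - ζ • 1)) * res H ζ' := by
        rw [mul_sub, sub_mul, mul_assoc, mul_res hH hζ', res_mul hH hζ, mul_one, one_mul]
    _ = _ := by rw [← h, mul_smul_comm, mul_one, smul_mul_assoc]

lemma res_sub_conjTranspose_col (hH : H.IsHermitian) (hζ : 0 < ζ.im) :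
    res H ζ - (res H ζ).conjTranspose =
      (2 * ζ.im * Complex.I) • ((res H ζ).conjTranspose * res H ζ) := by
  have h1 := congrArg Matrix.conjTranspose (mul_res hH hζ)
  rw [Matrix.conjTranspose_mul, conjTranspose_sub_smul_one hH, sub_conj_smul_one,
    Matrix.conjTranspose_one, ← sub_add, mul_add, mul_smul_comm, mul_one] at h1
  have h2 := congrArg (· * res H ζ) h1
  simp only [add_mul, Matrix.mul_assoc, mul_res hH hζ, mul_one, one_mul, smul_mul_assoc] at h2
  exact sub_eq_of_eq_add' h2.symm

lemma res_sub_conjTranspose_row (hH : H.IsHermitian) (hζ : 0 < ζ.im) :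
    res H ζ - (res H ζ).conjTranspose =
      (2 * ζ.im * Complex.I) • (res H ζ * (res H ζ).conjTranspose) := by
  have h1 := congrArg Matrix.conjTranspose (res_mul hH hζ)
  rw [Matrix.conjTranspose_mul, conjTranspose_sub_smul_one hH, sub_conj_smul_one,
    Matrix.conjTranspose_one, ← sub_add, add_mul, smul_mul_assoc, one_mul] at h1
  have h2 := congrArg (res H ζ * ·) h1
  simp only [mul_add, ← Matrix.mul_assoc, res_mul hH hζ, mul_one, one_mul, mul_smul_comm] at h2
  exact sub_eq_of_eq_add' h2.symm

lemma im_eq_of_sub_conj {a s N : ℂ} (h : a - starRingEnd ℂ a = 2 * N * Complex.I * s) :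
    (a.im : ℂ) = N * s := by
  rw [Complex.sub_conj] at h
  have hI : (2 * Complex.I : ℂ) ≠ 0 := by simp
  apply mul_left_cancel₀ hI
  push_cast at h
  linear_combination h

/-- Ward identity. -/
lemma ward_col (hH : H.IsHermitian) (hζ : 0 < ζ.im) (j : ι) :
    (res H ζ j j).im = ζ.im * ∑ k, ‖res H ζ k j‖ ^ 2 := by
  have h := congrFun (congrFun (res_sub_conjTranspose_col hH hζ) j) j
  simp only [Matrix.sub_apply, Matrix.smul_apply, Matrix.conjTranspose_apply, Matrix.mul_apply,
    smul_eq_mul] at h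
  have h2 := im_eq_of_sub_conj h
  rw [← Complex.ofReal_inj, h2]
  push_cast
  congr 1
  exact Finset.sum_congr rfl fun k _ => Complex.conj_mul' _

/-- Ward identity. -/
lemma ward_row (hH : H.IsHermitian) (hζ : 0 < ζ.im) (j : ι) :
    (res H ζ j j).im = ζ.im * ∑ k, ‖res H ζ j k‖ ^ 2 := by
  have h := congrFun (congrFun (res_sub_conjTranspose_row hH hζ) j) j
  simp only [Matrix.sub_apply, Matrix.smul_apply, Matrix.conjTranspose_apply, Matrix.mul_apply,
    smul_eq_mul] at h
  have h2 := im_eq_of_sub_conj h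
  rw [← Complex.ofReal_inj, h2]
  push_cast
  congr 1
  exact Finset.sum_congr rfl fun k _ => Complex.mul_conj' _

lemma norm_res_diag_le (hH : H.IsHermitian) (hζ : 0 < ζ.im) (j : ι) :
    ‖res H ζ j j‖ ≤ ζ.im⁻¹ := by
  have h1 := ward_col hH hζ j
  have h2 : ‖res H ζ j j‖ ^ 2 ≤ ∑ k, ‖res H ζ k j‖ ^ 2 :=
    Finset.single_le_sum (f := fun k => ‖res H ζ k j‖ ^ 2) (fun _ _ => by positivity)
      (Finset.mem_univ j)
  have h3 := (le_abs_self _).trans (Complex.abs_im_le_norm (res H ζ j j))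
  have h4 : ζ.im * ‖res H ζ j j‖ ^ 2 ≤ ‖res H ζ j j‖ := by
    rw [h1] at h3
    exact (mul_le_mul_of_nonneg_left h2 hζ.le).trans h3
  rcases (norm_nonneg (res H ζ j j)).eq_or_lt with h5 | h5
  · rw [← h5]
    positivity
  · rw [← one_div, le_div_iff₀ hζ]
    nlinarith

lemma sum_norm_sq_col_le (hH : H.IsHermitian) (hζ : 0 < ζ.im) (j : ι) :
    ∑ k, ‖res H ζ k j‖ ^ 2 ≤ ζ.im⁻¹ ^ 2 := by
  have h1 := ward_col hH hζ j
  have h3 := ((le_abs_self _).trans (Complex.abs_im_le_norm (res H ζ j j))).trans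
    (norm_res_diag_le hH hζ j)
  rw [h1] at h3
  rw [pow_two]
  calc ∑ k, ‖res H ζ k j‖ ^ 2 = ζ.im⁻¹ * (ζ.im * ∑ k, ‖res H ζ k j‖ ^ 2) := by
        rw [inv_mul_cancel_left₀ hζ.ne']
    _ ≤ _ := by gcongr

lemma sum_norm_sq_row_le (hH : H.IsHermitian) (hζ : 0 < ζ.im) (j : ι) :
    ∑ k, ‖res H ζ j k‖ ^ 2 ≤ ζ.im⁻¹ ^ 2 := by
  have h := (ward_row hH hζ j).symm.trans (ward_col hH hζ j)
  rw [mul_left_cancel₀ hζ.ne' h]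
  exact sum_norm_sq_col_le hH hζ j

lemma norm_res_le (hH : H.IsHermitian) (hζ : 0 < ζ.im) (i j : ι) : ‖res H ζ i j‖ ≤ ζ.im⁻¹ := by
  refine le_of_sq_le_sq ?_ (by positivity)
  exact (Finset.single_le_sum (f := fun k => ‖res H ζ k j‖ ^ 2) (fun _ _ => by positivity)
    (Finset.mem_univ i)).trans (sum_norm_sq_col_le hH hζ j)

lemma norm_res_mul_res_le (hH : H.IsHermitian) (hH' : H'.IsHermitian) (hζ : 0 < ζ.im)
    (hζ' : 0 < ζ'.im) (i j : ι) : ‖(res H ζ * res H' ζ') i j‖ ≤ ζ.im⁻¹ * ζ'.im⁻¹ := by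
  rw [Matrix.mul_apply]
  exact norm_sum_mul_le (sum_norm_sq_row_le hH hζ i) (sum_norm_sq_col_le hH' hζ' j)
    (mul_pow _ _ 2).symm.le (by positivity)

lemma im_res_diag_pos (hH : H.IsHermitian) (hζ : 0 < ζ.im) (j : ι) :
    0 < (res H ζ j j).im := by
  rw [ward_col hH hζ]
  refine mul_pos hζ ((Finset.sum_nonneg fun _ _ => by positivity).lt_of_ne fun h0 => ?_)
  rw [eq_comm, Finset.sum_eq_zero_iff_of_nonneg fun _ _ => by positivity] at h0
  have h1 := congrFun (congrFun (mul_res hH hζ) j) j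
  rw [Matrix.mul_apply, Finset.sum_eq_zero, Matrix.one_apply_eq] at h1
  · exact zero_ne_one h1
  · intro k hk
    have := h0 k hk
    rw [sq_eq_zero_iff, norm_eq_zero] at this
    rw [this, mul_zero]

lemma im_trace_res_pos [Nonempty ι] (hH : H.IsHermitian) (hζ : 0 < ζ.im) :
    0 < (res H ζ).trace.im := by
  rw [Matrix.trace, Complex.im_sum]
  exact Finset.sum_pos (fun j _ => im_res_diag_pos hH hζ j) Finset.univ_nonempty

lemma norm_trace_res_le (hH : H.IsHermitian) (hζ : 0 < ζ.im) :
    ‖(res H ζ).trace‖ ≤ Fintype.card ι * ζ.im⁻¹ := by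
  refine (norm_sum_le _ _).trans ((Finset.sum_le_card_nsmul _ _ ζ.im⁻¹
    fun j _ => norm_res_le hH hζ j j).trans ?_)
  rw [nsmul_eq_mul, Finset.card_univ]

lemma norm_trace_res_sub_le (hH : H.IsHermitian) (hζ : 0 < ζ.im) (hζ' : 0 < ζ'.im) :
    ‖(res H ζ).trace - (res H ζ').trace‖ ≤
      Fintype.card ι * (‖ζ - ζ'‖ * (ζ.im⁻¹ * ζ'.im⁻¹)) := by
  rw [← Matrix.trace_sub, res_sub_res_of_im_pos hH hζ hζ']
  refine (norm_sum_le _ _).trans ((Finset.sum_le_card_nsmul _ _ (‖ζ - ζ'‖ * (ζ.im⁻¹ * ζ'.im⁻¹))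
    fun j _ => ?_).trans ?_)
  · rw [Matrix.diag_apply, Matrix.smul_apply, norm_smul]
    exact mul_le_mul_of_nonneg_left (norm_res_mul_res_le hH hH hζ hζ' j j) (norm_nonneg _)
  · rw [nsmul_eq_mul, Finset.card_univ]

/-- The trace of the resolvent in terms of the spectrum. -/
lemma trace_res (hH : H.IsHermitian) (hζ : 0 < ζ.im) :
    (res H ζ).trace = ∑ i, ((hH.eigenvalues i : ℂ) - ζ)⁻¹ := by
  set U : Matrix ι ι ℂ := hH.eigenvectorUnitary.1 with hU
  have hUU : star U * U = 1 := Unitary.coe_star_mul_self hH.eigenvectorUnitary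
  have hUU' : U * star U = 1 := Unitary.coe_mul_star_self hH.eigenvectorUnitary
  have hspec : H = U * Matrix.diagonal (fun i => (hH.eigenvalues i : ℂ)) * star U := by
    have := hH.spectral_theorem
    rw [Unitary.conjStarAlgAut_apply] at this
    exact this
  have hne : ∀ i, (hH.eigenvalues i : ℂ) - ζ ≠ 0 := fun i => sub_ne_zero_of_im_pos _ hζ
  have hinv : res H ζ =
      U * Matrix.diagonal (fun i => ((hH.eigenvalues i : ℂ) - ζ)⁻¹) * star U := by
    refine Matrix.inv_eq_right_inv ?_
    have h1 : H - ζ • 1 =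
        U * Matrix.diagonal (fun i => (hH.eigenvalues i : ℂ) - ζ) * star U := by
      have h2 : Matrix.diagonal (fun i => (hH.eigenvalues i : ℂ) - ζ) =
          Matrix.diagonal (fun i => (hH.eigenvalues i : ℂ)) - ζ • 1 := by
        rw [Matrix.smul_one_eq_diagonal, Matrix.diagonal_sub]
      rw [h2, mul_sub, sub_mul, ← hspec, mul_smul_comm, smul_mul_assoc, mul_one, hUU']
    rw [h1]
    calc U * Matrix.diagonal (fun i => (hH.eigenvalues i : ℂ) - ζ) * star U *
          (U * Matrix.diagonal (fun i => ((hH.eigenvalues i : ℂ) - ζ)⁻¹) * star U)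
        = U * Matrix.diagonal (fun i => (hH.eigenvalues i : ℂ) - ζ) * (star U * U) *
          Matrix.diagonal (fun i => ((hH.eigenvalues i : ℂ) - ζ)⁻¹) * star U := by
          simp only [mul_assoc]
      _ = 1 := by
          rw [hUU, mul_one, mul_assoc U, Matrix.diagonal_mul_diagonal]
          simp only [mul_inv_cancel₀ (hne _)]
          rw [Matrix.diagonal_one, mul_one, hUU']
  rw [hinv, Matrix.trace_mul_comm, ← mul_assoc, hUU, one_mul, Matrix.trace_diagonal]

end Resolvent

/-- The resolvent of a principal minor, in terms of the resolvent of the whole matrix. -/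
lemma res_submatrix_castSucc {n : ℕ} {H : Matrix (Fin (n + 1)) (Fin (n + 1)) ℂ} {ζ : ℂ}
    (hH : H.IsHermitian) (hζ : 0 < ζ.im) (i j : Fin n) :
    res (H.submatrix Fin.castSucc Fin.castSucc) ζ i j = res H ζ i.castSucc j.castSucc -
      res H ζ i.castSucc (Fin.last n) *
        (res H ζ (Fin.last n) j.castSucc / res H ζ (Fin.last n) (Fin.last n)) := by
  have hl : res H ζ (Fin.last n) (Fin.last n) ≠ 0 := fun h0 =>
    (im_res_diag_pos hH hζ (Fin.last n)).ne' (by rw [h0, Complex.zero_im])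
  revert i j
  suffices h : res (H.submatrix Fin.castSucc Fin.castSucc) ζ = Matrix.of fun i j =>
      res H ζ i.castSucc j.castSucc - res H ζ i.castSucc (Fin.last n) *
        (res H ζ (Fin.last n) j.castSucc / res H ζ (Fin.last n) (Fin.last n)) by
    intro i j
    rw [h, Matrix.of_apply]
  refine Matrix.inv_eq_right_inv ?_
  ext i j
  have h1 := congrFun (congrFun (mul_res hH hζ) i.castSucc) j.castSucc
  have h2 := congrFun (congrFun (mul_res hH hζ) i.castSucc) (Fin.last n)
  rw [Matrix.mul_apply, Fin.sum_univ_castSucc] at h1 h2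
  have h3 : ∀ k : Fin n, (H.submatrix Fin.castSucc Fin.castSucc - ζ • 1) i k =
      (H - ζ • 1) i.castSucc k.castSucc := fun k => by
    simp [Matrix.one_apply]
  rw [Matrix.one_apply_ne (Fin.castSucc_lt_last i).ne] at h2
  have h4 : (1 : Matrix (Fin (n + 1)) (Fin (n + 1)) ℂ) i.castSucc j.castSucc =
      (1 : Matrix (Fin n) (Fin n) ℂ) i j := by
    simp [Matrix.one_apply]
  rw [h4] at h1
  rw [Matrix.mul_apply]
  simp only [h3, Matrix.of_apply, mul_sub, Finset.sum_sub_distrib, ← mul_assoc, ← Finset.sum_mul]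
  rw [← h1, eq_neg_of_add_eq_zero_left h2, neg_mul, sub_neg_eq_add]
  congr 1
  rw [mul_assoc, mul_div_cancel₀ _ hl]

/-- Removing one row and the corresponding column changes the trace of the resolvent by a bounded
amount, whatever the size of the entries: with `l` the removed index, the change is `(R²)ₗₗ / Rₗₗ`,
and the Ward identities bound the numerator by `Im Rₗₗ / Im ζ`. -/
lemma norm_trace_res_submatrix_sub_le {n : ℕ} {H : Matrix (Fin (n + 1)) (Fin (n + 1)) ℂ} {ζ : ℂ}
    (hH : H.IsHermitian) (hζ : 0 < ζ.im) :
    ‖(res H ζ).trace - (res (H.submatrix Fin.castSucc Fin.castSucc) ζ).trace‖ ≤ ζ.im⁻¹ := by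
  have hl : res H ζ (Fin.last n) (Fin.last n) ≠ 0 := fun h0 =>
    (im_res_diag_pos hH hζ (Fin.last n)).ne' (by rw [h0, Complex.zero_im])
  have h1 : (res H ζ).trace - (res (H.submatrix Fin.castSucc Fin.castSucc) ζ).trace =
      (∑ k, res H ζ (Fin.last n) k * res H ζ k (Fin.last n)) /
        res H ζ (Fin.last n) (Fin.last n) := by
    simp only [Matrix.trace, Matrix.diag_apply, res_submatrix_castSucc hH hζ,
      Finset.sum_sub_distrib]
    rw [Fin.sum_univ_castSucc, Fin.sum_univ_castSucc, add_div, mul_div_cancel_right₀ _ hl,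
      Finset.sum_div, add_sub_sub_cancel, add_comm]
    congr 1
    exact Finset.sum_congr rfl fun k _ => by ring
  have hcol := ward_col hH hζ (Fin.last n)
  have hrow := ward_row hH hζ (Fin.last n)
  have hle := (le_abs_self _).trans (Complex.abs_im_le_norm (res H ζ (Fin.last n) (Fin.last n)))
  have hpos := (im_res_diag_pos hH hζ (Fin.last n)).le
  generalize res H ζ (Fin.last n) (Fin.last n) = q at *
  have h2 : ‖∑ k, res H ζ (Fin.last n) k * res H ζ k (Fin.last n)‖ ≤ ζ.im⁻¹ * q.im := by
    refine norm_sum_mul_le (A := ζ.im⁻¹ * q.im) (B := ζ.im⁻¹ * q.im) ?_ ?_ (pow_two _).symm.le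
      (by positivity)
    · rw [hrow, inv_mul_cancel_left₀ hζ.ne']
    · rw [hcol, inv_mul_cancel_left₀ hζ.ne']
  rw [h1, norm_div]
  exact div_le_of_le_mul₀ (norm_nonneg _) (by positivity)
    (h2.trans (mul_le_mul_of_nonneg_left hle (by positivity)))

/-! ### Variance of a function of independent variables -/

section Resampling

variable {ι Ω : Type*} [MeasurableSpace Ω] {P : Measure Ω} {x : ι → Ω → ℝ}

lemma indepFun_update_zero [DecidableEq ι] (hm : ∀ p, Measurable (x p)) (hx : iIndepFun x P)
    (p : ι) :
    IndepFun (fun ω => Function.update (fun q => x q ω) p 0) (x p) P := by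
  have h := indep_iSup_of_disjoint (fun q => (hm q).comap_le) hx.iIndep
    (S := {q | q ≠ p}) (T := {p}) (by simp)
  rw [IndepFun_iff_Indep]
  refine indep_of_indep_of_le_left (indep_of_indep_of_le_right h ?_) ?_
  · exact le_iSup₂_of_le p rfl le_rfl
  · rw [← measurable_iff_comap_le]
    refine @measurable_pi_lambda _ _ _ (_) _ _ fun q => ?_
    by_cases hq : q = p
    · subst hq
      simp
    · simp only [Function.update_of_ne hq]
      rw [measurable_iff_comap_le]
      exact le_iSup₂_of_le (f := fun q (_ : q ∈ {q | q ≠ p}) =>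
        MeasurableSpace.comap (x q) inferInstance) q hq le_rfl

variable [IsProbabilityMeasure P]

lemma integrable_comp_family {E : Type*} [NormedAddCommGroup E] [MeasurableSpace E] [BorelSpace E]
    [SecondCountableTopology E] (hm : ∀ p, Measurable (x p)) {f : (ι → ℝ) → E} (hf : Measurable f)
    {C : ℝ} (hC : ∀ y, ‖f y‖ ≤ C) : Integrable (fun ω => f fun q => x q ω) P :=
  .of_bound (hf.comp (measurable_pi_lambda _ hm)).aestronglyMeasurable C
    (ae_of_all _ fun _ => hC _)

variable [DecidableEq ι]

/-- Resampling one of the independent variables does not change the expectation. -/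
lemma integral_resample {E : Type*} [NormedAddCommGroup E] [NormedSpace ℝ E] [MeasurableSpace E]
    [BorelSpace E] [SecondCountableTopology E] (hm : ∀ p, Measurable (x p))
    (hx : iIndepFun x P) (p : ι) {h : (ι → ℝ) → E} (hh : Measurable h) {C : ℝ}
    (hC : ∀ y, ‖h y‖ ≤ C) :
    ∫ ω, h (fun q => x q ω) ∂P =
      ∫ ω, ∫ t, h (Function.update (fun q => x q ω) p t) ∂(P.map (x p)) ∂P := by
  set Y : Ω → ι → ℝ := fun ω => Function.update (fun q => x q ω) p 0 with hY
  have hYm : Measurable Y := by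
    refine measurable_pi_lambda _ fun q => ?_
    by_cases hq : q = p
    · subst hq
      simp [hY]
    · simpa [hY, Function.update_of_ne hq] using hm q
  have := Measure.isProbabilityMeasure_map (μ := P) (hm p).aemeasurable
  have := Measure.isProbabilityMeasure_map (μ := P) hYm.aemeasurable
  have hprod := (indepFun_iff_map_prod_eq_prod_map_map hYm.aemeasurable (hm p).aemeasurable).1
    (indepFun_update_zero hm hx p)
  have hhm : Measurable fun z : (ι → ℝ) × ℝ => h (Function.update z.1 p z.2) :=
    hh.comp measurable_update'
  calc ∫ ω, h (fun q => x q ω) ∂P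
      = ∫ ω, h (Function.update (Y ω) p (x p ω)) ∂P := by
        refine integral_congr_ae (ae_of_all _ fun ω => ?_)
        simp [hY]
    _ = ∫ z, h (Function.update z.1 p z.2) ∂(P.map fun ω => (Y ω, x p ω)) := by
        rw [integral_map (hYm.prodMk (hm p)).aemeasurable hhm.aestronglyMeasurable]
    _ = ∫ y, ∫ t, h (Function.update y p t) ∂(P.map (x p)) ∂(P.map Y) := by
        rw [hprod, integral_prod]
        exact .of_bound hhm.aestronglyMeasurable C (ae_of_all _ fun _ => hC _)
    _ = ∫ ω, ∫ t, h (Function.update (Y ω) p t) ∂(P.map (x p)) ∂P := by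
        rw [integral_map hYm.aemeasurable]
        exact hhm.stronglyMeasurable.integral_prod_right'.aestronglyMeasurable
    _ = _ := by simp [hY]

lemma integral_sub_const_sq {α : Type*} [MeasurableSpace α] {ν : Measure α}
    [IsProbabilityMeasure ν] {f : α → ℝ} (hf : MemLp f 2 ν) (a : ℝ) :
    ∫ t, (f t - a) ^ 2 ∂ν = ∫ t, f t ^ 2 ∂ν - 2 * a * ∫ t, f t ∂ν + a ^ 2 := by
  have h1 : Integrable (fun t => 2 * a * f t) ν := (hf.integrable one_le_two).const_mul _
  have h2 := hf.integrable_sq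
  have h3 : Integrable (fun t => f t ^ 2 - 2 * a * f t) ν := h2.sub h1
  have : ∀ t, (f t - a) ^ 2 = f t ^ 2 - 2 * a * f t + a ^ 2 := fun t => by ring
  simp only [this]
  rw [integral_add h3 (integrable_const _), integral_sub h2 h1, integral_const_mul]
  simp

/-- The mean square distance to `m`, decomposed with a competitor `c` of the mean. -/
lemma integral_sub_sq_le {α : Type*} [MeasurableSpace α] {ν : Measure α} [IsProbabilityMeasure ν]
    {f : α → ℝ} (hf : MemLp f 2 ν) (m c : ℝ) :
    ∫ t, (f t - m) ^ 2 ∂ν ≤ ∫ t, (f t - c) ^ 2 ∂ν + (∫ t, f t ∂ν - m) ^ 2 := by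
  rw [integral_sub_const_sq hf, integral_sub_const_sq hf]
  nlinarith [sq_nonneg (∫ t, f t ∂ν - c)]

lemma sq_integral_le {α : Type*} [MeasurableSpace α] {ν : Measure α} [IsProbabilityMeasure ν]
    {f : α → ℝ} (hf : MemLp f 2 ν) : (∫ t, f t ∂ν) ^ 2 ≤ ∫ t, f t ^ 2 ∂ν := by
  have h : 0 ≤ ∫ t, (f t - ∫ t, f t ∂ν) ^ 2 ∂ν := integral_nonneg fun t => sq_nonneg _
  rw [integral_sub_const_sq hf] at h
  linarith

/-- A form of the Efron–Stein inequality: the variance of a function of finitely many independent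
variables is at most the sum of the mean square effects of replacing one variable by `0`. -/
lemma variance_le_sum_update_zero (hm : ∀ p, Measurable (x p)) (hx : iIndepFun x P) (S : Finset ι)
    {f : (ι → ℝ) → ℝ} (hf : Measurable f) {C : ℝ} (hC : ∀ y, |f y| ≤ C) (hS : DependsOn f S) :
    ∫ ω, (f (fun q => x q ω) - ∫ ω', f (fun q => x q ω') ∂P) ^ 2 ∂P ≤
      ∑ p ∈ S, ∫ ω, (f (fun q => x q ω) - f (Function.update (fun q => x q ω) p 0)) ^ 2 ∂P := by
  induction S using Finset.induction_on generalizing f with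
  | empty =>
    have h : ∀ y, f y = f 0 := fun y => hS (by simp)
    simp [h (fun q => x q _)]
  | insert p S hp ih =>
    rw [Finset.sum_insert hp]
    set ν := P.map (x p) with hν
    have hνp : IsProbabilityMeasure ν :=
      Measure.isProbabilityMeasure_map (μ := P) (hm p).aemeasurable
    have hC0 : 0 ≤ C := (abs_nonneg _).trans (hC 0)
    have hum : Measurable fun z : (ι → ℝ) × ℝ => f (Function.update z.1 p z.2) :=
      hf.comp measurable_update'
    set g : (ι → ℝ) → ℝ := fun y => ∫ t, f (Function.update y p t) ∂ν with hg
    have hgm : Measurable g := hum.stronglyMeasurable.integral_prod_right'.measurable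
    have hgC : ∀ y, |g y| ≤ C := fun y => by
      simpa using norm_integral_le_of_norm_le_const (μ := ν)
        (f := fun t => f (Function.update y p t)) (ae_of_all _ fun t => hC _)
    have hgS : DependsOn g S := by
      intro y y' hy
      refine integral_congr_ae (ae_of_all _ fun t => hS fun q hq => ?_)
      by_cases hqp : q = p
      · subst hqp
        simp
      · rw [Function.update_of_ne hqp, Function.update_of_ne hqp]
        exact hy q ((Finset.mem_insert.1 hq).resolve_left hqp)
    have hup : ∀ q (a : ℝ), Measurable fun y : ι → ℝ => Function.update y q a :=
      fun q a => measurable_update_left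
    have hL2 : ∀ y, MemLp (fun t => f (Function.update y p t)) 2 ν := fun y =>
      .of_bound (hf.comp (measurable_update y)).aestronglyMeasurable C (ae_of_all _ fun t => hC _)
    have hsq : ∀ (u v : ℝ), |u| ≤ C → |v| ≤ C → ‖(u - v) ^ 2‖ ≤ (2 * C) ^ 2 := by
      intro u v hu hv
      rw [Real.norm_eq_abs, abs_pow]
      exact pow_le_pow_left₀ (abs_nonneg _) ((abs_sub u v).trans (by linarith)) 2
    set m := ∫ ω, f (fun q => x q ω) ∂P with hmdef
    have hmg : ∫ ω, g (fun q => x q ω) ∂P = m := (integral_resample hm hx p hf hC).symm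
    have hmC : |m| ≤ C := by
      simpa using norm_integral_le_of_norm_le_const (μ := P) (f := fun ω => f fun q => x q ω)
        (ae_of_all _ fun t => hC _)
    -- Integrate the variable `x p` first.
    have step1 : ∫ ω, (f (fun q => x q ω) - m) ^ 2 ∂P ≤
        ∫ ω, (f (fun q => x q ω) - f (Function.update (fun q => x q ω) p 0)) ^ 2 ∂P +
          ∫ ω, (g (fun q => x q ω) - m) ^ 2 ∂P := by
      have hA : Measurable fun y => (f y - m) ^ 2 := (hf.sub_const m).pow_const 2
      have hB : Measurable fun y => (f y - f (Function.update y p 0)) ^ 2 :=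
        (hf.sub (hf.comp (hup p 0))).pow_const 2
      have hBu : Measurable fun z : (ι → ℝ) × ℝ =>
          (f (Function.update z.1 p z.2) - f (Function.update z.1 p 0)) ^ 2 := by
        exact (hum.sub ((hf.comp (hup p 0)).comp measurable_fst)).pow_const 2
      have hAu : Measurable fun z : (ι → ℝ) × ℝ => (f (Function.update z.1 p z.2) - m) ^ 2 :=
        (hum.sub_const m).pow_const 2
      rw [integral_resample hm hx p hA (fun y => hsq _ _ (hC _) hmC),
        integral_resample hm hx p hB (fun y => hsq _ _ (hC _) (hC _))]
      simp only [Function.update_idem]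
      rw [← integral_add]
      · refine integral_mono ?_ ?_ fun ω => integral_sub_sq_le (hL2 _) _ _
        · refine integrable_comp_family (f := fun y => ∫ t, (f (Function.update y p t) - m) ^ 2 ∂ν)
            (C := (2 * C) ^ 2) hm hAu.stronglyMeasurable.integral_prod_right'.measurable fun y => ?_
          simpa using norm_integral_le_of_norm_le_const (μ := ν)
            (ae_of_all _ fun t => hsq _ _ (hC (Function.update y p t)) hmC)
        · refine integrable_comp_family (f := fun y =>
              ∫ t, (f (Function.update y p t) - f (Function.update y p 0)) ^ 2 ∂ν + (g y - m) ^ 2)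
            (C := (2 * C) ^ 2 + (2 * C) ^ 2) hm
            (hBu.stronglyMeasurable.integral_prod_right'.measurable.add
              ((hgm.sub_const m).pow_const 2)) fun y => ?_
          refine (norm_add_le _ _).trans (add_le_add ?_ (hsq _ _ (hgC _) hmC))
          simpa using norm_integral_le_of_norm_le_const (μ := ν)
            (ae_of_all _ fun t => hsq _ _ (hC (Function.update y p t)) (hC (Function.update y p 0)))
      · refine integrable_comp_family (f := fun y =>
              ∫ t, (f (Function.update y p t) - f (Function.update y p 0)) ^ 2 ∂ν)
            (C := (2 * C) ^ 2) hm hBu.stronglyMeasurable.integral_prod_right'.measurable fun y => ?_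
        simpa using norm_integral_le_of_norm_le_const (μ := ν)
            (ae_of_all _ fun t => hsq _ _ (hC (Function.update y p t)) (hC (Function.update y p 0)))
      · exact integrable_comp_family hm ((hgm.sub_const m).pow_const 2)
          fun y => hsq _ _ (hgC _) hmC
    have step2 : ∫ ω, (g (fun q => x q ω) - m) ^ 2 ∂P ≤
        ∑ q ∈ S, ∫ ω, (g (fun q => x q ω) - g (Function.update (fun q => x q ω) q 0)) ^ 2 ∂P := by
      have := ih hgm hgC hgS
      rwa [hmg] at this
    -- Averaging over `x p` does not increase the effect of the other variables, by Jensen.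
    refine step1.trans (add_le_add le_rfl (step2.trans (Finset.sum_le_sum fun q hq => ?_)))
    have hqp : q ≠ p := fun h => hp (h ▸ hq)
    have hD : Measurable fun y => (f y - f (Function.update y q 0)) ^ 2 :=
      (hf.sub (hf.comp (hup q 0))).pow_const 2
    have hDu : Measurable fun z : (ι → ℝ) × ℝ => (f (Function.update z.1 p z.2) -
        f (Function.update (Function.update z.1 p z.2) q 0)) ^ 2 :=
      hD.comp measurable_update'
    rw [integral_resample hm hx p hD (fun y => hsq _ _ (hC _) (hC _))]
    refine integral_mono ?_ ?_ fun ω => ?_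
    · exact integrable_comp_family hm ((hgm.sub (hgm.comp (hup q 0))).pow_const 2)
        fun y => hsq _ _ (hgC _) (hgC _)
    · refine integrable_comp_family (f := fun y => ∫ t, (f (Function.update y p t) -
          f (Function.update (Function.update y p t) q 0)) ^ 2 ∂ν)
        (C := (2 * C) ^ 2) hm hDu.stronglyMeasurable.integral_prod_right'.measurable fun y => ?_
      simpa using norm_integral_le_of_norm_le_const (μ := ν) (ae_of_all _ fun t =>
        hsq _ _ (hC (Function.update y p t)) (hC (Function.update (Function.update y p t) q 0)))
    · have h1 := hL2 (fun q => x q ω)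
      have h2 := hL2 (Function.update (fun q => x q ω) q 0)
      have hcomm : ∀ t, Function.update (Function.update (fun q => x q ω) p t) q 0 =
          Function.update (Function.update (fun q => x q ω) q 0) p t := fun t =>
        Function.update_comm hqp.symm _ _ _
      simp only [hg, hcomm]
      rw [← integral_sub (h1.integrable one_le_two) (h2.integrable one_le_two)]
      exact sq_integral_le (h1.sub h2)

end Resampling

/-! ### The Hermitian matrix `i W̃ₙ` and its resolvent -/

lemma sgn_swap (a b : ℕ) : sgn b a = -sgn a b := by
  unfold sgn
  rcases lt_trichotomy a b with h | h | h
  · simp [h.ne, h.ne', h, h.not_gt]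
  · simp [h]
  · simp [h.ne, h.ne', h, h.not_gt]

lemma abs_sgn {a b : ℕ} (h : a ≠ b) : |sgn a b| = 1 := by
  unfold sgn
  rw [if_neg h]
  split_ifs <;> simp

lemma wignerLink_comm (a b : ℕ) : wignerLink a b = wignerLink b a := by
  simp [wignerLink, min_comm, max_comm]

lemma wignerLink_eq_iff {a b c d : ℕ} :
    wignerLink a b = wignerLink c d ↔ (a = c ∧ b = d) ∨ (a = d ∧ b = c) := by
  simp only [wignerLink, Subtype.mk.injEq, Prod.mk.injEq]
  omega

/-- The Hermitian matrix `i W̃ₙ`, as a function of the array `y` of input variables. -/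
def herm (n : ℕ) (y : InputIndex → ℝ) : Matrix (Fin n) (Fin n) ℂ :=
  Matrix.of fun i j => Complex.I * (sgn i j * y (wignerLink i j) : ℝ)

variable {n : ℕ} {ζ : ℂ}

lemma herm_apply (y : InputIndex → ℝ) (i j : Fin n) :
    herm n y i j = Complex.I * (sgn i j * y (wignerLink i j) : ℝ) := rfl

lemma herm_swap (y : InputIndex → ℝ) (i j : Fin n) : herm n y j i = -herm n y i j := by
  rw [herm_apply, herm_apply, sgn_swap i j, wignerLink_comm j i]
  push_cast
  ring

lemma isHermitian_herm (n : ℕ) (y : InputIndex → ℝ) : (herm n y).IsHermitian := by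
  ext i j
  rw [Matrix.conjTranspose_apply, herm_swap, herm_apply]
  simp

lemma norm_herm {i j : Fin n} (hij : i ≠ j) (y : InputIndex → ℝ) :
    ‖herm n y i j‖ = |y (wignerLink i j)| := by
  rw [herm_apply, norm_mul, Complex.norm_I, one_mul, Complex.norm_real, Real.norm_eq_abs, abs_mul,
    abs_sgn (fun h => hij (Fin.ext h)), one_mul]

lemma herm_sq {i j : Fin n} (hij : i ≠ j) (y : InputIndex → ℝ) :
    herm n y i j ^ 2 = -((y (wignerLink i j) ^ 2 : ℝ) : ℂ) := by
  have h : sgn i j ^ 2 = 1 := by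
    rw [← sq_abs, abs_sgn (fun h => hij (Fin.ext h)), one_pow]
  rw [herm_apply, mul_pow, Complex.I_sq, ← Complex.ofReal_pow, mul_pow, h, one_mul, neg_one_mul]

lemma herm_diag (y : InputIndex → ℝ) (i : Fin n) : herm n y i i = 0 := by
  simp [herm_apply, sgn]

lemma submatrix_herm (y : InputIndex → ℝ) :
    (herm (n + 1) y).submatrix Fin.castSucc Fin.castSucc = herm n y := rfl

/-- Setting the variable of the positions `(i, j)` and `(j, i)` to zero is a perturbation supported
on these two positions. -/
lemma herm_sub_herm_update {i j : Fin n} (hij : i ≠ j) (y : InputIndex → ℝ) :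
    herm n y - herm n (Function.update y (wignerLink i j) 0) =
      Matrix.single i j (herm n y i j) - Matrix.single j i (herm n y i j) := by
  ext k l
  simp only [Matrix.sub_apply, Matrix.single_apply]
  by_cases h1 : i = k ∧ j = l
  · obtain ⟨rfl, rfl⟩ := h1
    simp [herm_apply, hij, hij.symm]
  · by_cases h2 : j = k ∧ i = l
    · obtain ⟨rfl, rfl⟩ := h2
      rw [herm_swap y i j]
      simp [herm_apply, hij, hij.symm, wignerLink_comm (j : ℕ) i]
    · have h3 : wignerLink k l ≠ wignerLink i j := by
        rw [Ne, wignerLink_eq_iff]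
        rintro (⟨h, h'⟩ | ⟨h, h'⟩)
        · exact h1 ⟨Fin.ext h.symm, Fin.ext h'.symm⟩
        · exact h2 ⟨Fin.ext h.symm, Fin.ext h'.symm⟩
      simp [herm_apply, h1, h2, Function.update_of_ne h3]

lemma herm_update_diag (i : Fin n) (y : InputIndex → ℝ) :
    herm n (Function.update y (wignerLink i i) 0) = herm n y := by
  ext k l
  by_cases h : wignerLink k l = wignerLink i i
  · have : k = l := by
      rw [wignerLink_eq_iff] at h
      exact Fin.ext (by omega)
    subst this
    rw [herm_diag, herm_diag]
  · rw [herm_apply, herm_apply, Function.update_of_ne h]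

lemma res_update_sub_res_matrix {i j : Fin n} (hij : i ≠ j) (hζ : 0 < ζ.im)
    (y : InputIndex → ℝ) (k l : Fin n) :
    res (herm n (Function.update y (wignerLink i j) 0)) ζ k l - res (herm n y) ζ k l =
      herm n y i j *
        (res (herm n (Function.update y (wignerLink i j) 0)) ζ k i * res (herm n y) ζ j l -
          res (herm n (Function.update y (wignerLink i j) 0)) ζ k j * res (herm n y) ζ i l) := by
  have h := congrFun (congrFun (res_sub_res (isHermitian_herm n y)
    (isHermitian_herm n (Function.update y (wignerLink i j) 0)) hζ) k) l
  rw [Matrix.sub_apply] at h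
  rw [h, herm_sub_herm_update hij, mul_sub, sub_mul, Matrix.sub_apply]
  generalize res (herm n (Function.update y (wignerLink i j) 0)) ζ = A
  generalize res (herm n y) ζ = B
  have key : ∀ (a b : Fin n) (c : ℂ), (A * Matrix.single a b c * B) k l = A k a * c * B b l := by
    intro a b c
    rw [Matrix.mul_apply, Finset.sum_eq_single b]
    · rw [Matrix.mul_single_apply_same]
    · intro d _ hd
      rw [Matrix.mul_single_apply_of_ne _ _ _ _ _ hd, zero_mul]
    · simp
  rw [key, key]
  ring

lemma norm_res_update_sub_res_le {i j : Fin n} (hij : i ≠ j) (hζ : 0 < ζ.im)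
    (y : InputIndex → ℝ) (k l : Fin n) :
    ‖res (herm n (Function.update y (wignerLink i j) 0)) ζ k l - res (herm n y) ζ k l‖ ≤
      2 * |y (wignerLink i j)| * ζ.im⁻¹ ^ 2 := by
  have hN : 0 ≤ ζ.im⁻¹ := by positivity
  have h0 := norm_res_le (isHermitian_herm n (Function.update y (wignerLink i j) 0)) hζ
  have h1 := norm_res_le (isHermitian_herm n y) hζ
  rw [res_update_sub_res_matrix hij hζ, norm_mul, norm_herm hij]
  have h2 := norm_sub_le
    (res (herm n (Function.update y (wignerLink i j) 0)) ζ k i * res (herm n y) ζ j l)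
    (res (herm n (Function.update y (wignerLink i j) 0)) ζ k j * res (herm n y) ζ i l)
  rw [norm_mul, norm_mul] at h2
  have h3 := mul_le_mul (h0 k i) (h1 j l) (norm_nonneg _) hN
  have h4 := mul_le_mul (h0 k j) (h1 i l) (norm_nonneg _) hN
  calc _ ≤ |y (wignerLink i j)| * (ζ.im⁻¹ * ζ.im⁻¹ + ζ.im⁻¹ * ζ.im⁻¹) :=
        mul_le_mul_of_nonneg_left (h2.trans (add_le_add h3 h4)) (abs_nonneg _)
    _ = _ := by ring

/-- The influence of one variable on the trace of the resolvent. -/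
lemma norm_trace_res_sub_update_le (hζ : 0 < ζ.im) (y : InputIndex → ℝ) (i j : Fin n) :
    ‖(res (herm n y) ζ).trace - (res (herm n (Function.update y (wignerLink i j) 0)) ζ).trace‖ ≤
      2 * |y (wignerLink i j)| * ζ.im⁻¹ ^ 2 := by
  by_cases hij : i = j
  · subst hij
    rw [herm_update_diag, sub_self, norm_zero]
    positivity
  have hH := isHermitian_herm n y
  have hH0 := isHermitian_herm n (Function.update y (wignerLink i j) 0)
  have h : (res (herm n (Function.update y (wignerLink i j) 0)) ζ).trace -
      (res (herm n y) ζ).trace = herm n y i j *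
      ((res (herm n y) ζ * res (herm n (Function.update y (wignerLink i j) 0)) ζ) j i -
        (res (herm n y) ζ * res (herm n (Function.update y (wignerLink i j) 0)) ζ) i j) := by
    simp only [Matrix.trace, Matrix.diag_apply, Matrix.mul_apply, ← Finset.sum_sub_distrib,
      Finset.mul_sum]
    refine Finset.sum_congr rfl fun k _ => ?_
    rw [res_update_sub_res_matrix hij hζ]
    ring
  rw [norm_sub_rev, h, norm_mul, norm_herm hij]
  calc _ ≤ |y (wignerLink i j)| * (ζ.im⁻¹ * ζ.im⁻¹ + ζ.im⁻¹ * ζ.im⁻¹) :=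
        mul_le_mul_of_nonneg_left ((norm_sub_le _ _).trans (add_le_add
          (norm_res_mul_res_le hH hH0 hζ hζ j i) (norm_res_mul_res_le hH hH0 hζ hζ i j)))
          (abs_nonneg _)
    _ = _ := by ring

/-- Expansion of one summand of `tr (H R)` around the matrix in which the variable of that summand
is set to zero. -/
lemma norm_herm_mul_res_sub_le {i j : Fin n} (hij : i ≠ j) (hζ : 0 < ζ.im)
    (y : InputIndex → ℝ) :
    ‖herm n y i j * res (herm n y) ζ j i -
      (herm n y i j * res (herm n (Function.update y (wignerLink i j) 0)) ζ j i +
        ((y (wignerLink i j) ^ 2 : ℝ) : ℂ) *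
          (res (herm n (Function.update y (wignerLink i j) 0)) ζ j i ^ 2 -
            res (herm n (Function.update y (wignerLink i j) 0)) ζ j j *
              res (herm n (Function.update y (wignerLink i j) 0)) ζ i i))‖ ≤
      4 * ζ.im⁻¹ ^ 2 * (y (wignerLink i j) ^ 2 * min 1 (|y (wignerLink i j)| * ζ.im⁻¹)) := by
  have hN : 0 ≤ ζ.im⁻¹ := by positivity
  have hd := res_update_sub_res_matrix hij hζ y j i
  have h0 := norm_res_le (isHermitian_herm n (Function.update y (wignerLink i j) 0)) hζ
  have h1 := norm_res_le (isHermitian_herm n y) hζ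
  have hle := norm_res_update_sub_res_le hij hζ y
  have hsq := herm_sq hij y
  set x := y (wignerLink i j)
  set R := res (herm n y) ζ
  set R₀ := res (herm n (Function.update y (wignerLink i j) 0)) ζ
  -- The bound by `1` keeps the error integrable when only second moments exist, the other bound
  -- makes it small.
  have hmin : ∀ k l, ‖R k l - R₀ k l‖ ≤ 2 * ζ.im⁻¹ * min 1 (|x| * ζ.im⁻¹) := by
    intro k l
    rw [mul_min_of_nonneg _ _ (by positivity)]
    refine le_min ?_ ?_
    · refine (norm_sub_le _ _).trans ((add_le_add (h1 k l) (h0 k l)).trans (le_of_eq ?_))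
      ring
    · rw [norm_sub_rev]
      refine (hle k l).trans (le_of_eq ?_)
      ring
  have e : herm n y i j * R j i - (herm n y i j * R₀ j i +
      ((x ^ 2 : ℝ) : ℂ) * (R₀ j i ^ 2 - R₀ j j * R₀ i i)) =
      ((x ^ 2 : ℝ) : ℂ) * (R₀ j i * (R j i - R₀ j i) - R₀ j j * (R i i - R₀ i i)) := by
    linear_combination (-herm n y i j) * hd - (R₀ j i * R j i - R₀ j j * R i i) * hsq
  rw [e, norm_mul, Complex.norm_real, Real.norm_of_nonneg (sq_nonneg x)]
  have h2 := norm_sub_le (R₀ j i * (R j i - R₀ j i)) (R₀ j j * (R i i - R₀ i i))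
  rw [norm_mul, norm_mul] at h2
  have h3 := mul_le_mul (h0 j i) (hmin j i) (norm_nonneg _) hN
  have h4 := mul_le_mul (h0 j j) (hmin i i) (norm_nonneg _) hN
  calc _ ≤ x ^ 2 * (ζ.im⁻¹ * (2 * ζ.im⁻¹ * min 1 (|x| * ζ.im⁻¹)) +
        ζ.im⁻¹ * (2 * ζ.im⁻¹ * min 1 (|x| * ζ.im⁻¹))) :=
        mul_le_mul_of_nonneg_left (h2.trans (add_le_add h3 h4)) (sq_nonneg _)
    _ = _ := by ring

lemma norm_res_quadratic_sub_le {i j : Fin n} (hij : i ≠ j) (hζ : 0 < ζ.im)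
    (y : InputIndex → ℝ) :
    ‖(res (herm n (Function.update y (wignerLink i j) 0)) ζ j i ^ 2 -
        res (herm n (Function.update y (wignerLink i j) 0)) ζ j j *
          res (herm n (Function.update y (wignerLink i j) 0)) ζ i i) -
      (res (herm n y) ζ j i ^ 2 - res (herm n y) ζ j j * res (herm n y) ζ i i)‖ ≤
      8 * ζ.im⁻¹ ^ 3 * |y (wignerLink i j)| := by
  have hN : 0 ≤ ζ.im⁻¹ := by positivity
  have h0 := norm_res_le (isHermitian_herm n (Function.update y (wignerLink i j) 0)) hζ
  have h1 := norm_res_le (isHermitian_herm n y) hζ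
  have hle := norm_res_update_sub_res_le hij hζ y
  set x := y (wignerLink i j)
  set R := res (herm n y) ζ
  set R₀ := res (herm n (Function.update y (wignerLink i j) 0)) ζ
  have e : (R₀ j i ^ 2 - R₀ j j * R₀ i i) - (R j i ^ 2 - R j j * R i i) =
      (R₀ j i - R j i) * (R₀ j i + R j i) -
        ((R₀ j j - R j j) * R₀ i i + (R₀ i i - R i i) * R j j) := by
    ring
  have hD : 0 ≤ 2 * |x| * ζ.im⁻¹ ^ 2 := by positivity
  rw [e]
  refine (norm_sub_le _ _).trans ((add_le_add_right (norm_add_le _ _) _).trans ?_)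
  simp only [norm_mul]
  have a1 := mul_le_mul (hle j i) ((norm_add_le _ _).trans (add_le_add (h0 j i) (h1 j i)))
    (norm_nonneg _) hD
  have a2 := mul_le_mul (hle j j) (h0 i i) (norm_nonneg _) hD
  have a3 := mul_le_mul (hle i i) (h1 j j) (norm_nonneg _) hD
  refine (add_le_add a1 (add_le_add a2 a3)).trans (le_of_eq ?_)
  ring

/-- The trace form of `H R = 1 + ζ R`, arranged around the self-consistent equation. -/
lemma trace_equation (hζ : 0 < ζ.im) (y : InputIndex → ℝ) :
    (n : ℂ) + ζ * (res (herm n y) ζ).trace + (res (herm n y) ζ).trace ^ 2 =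
      ∑ i, ∑ j, (herm n y i j * res (herm n y) ζ j i -
        (res (herm n y) ζ j i ^ 2 - res (herm n y) ζ j j * res (herm n y) ζ i i)) +
      ∑ i, ∑ j, res (herm n y) ζ j i ^ 2 := by
  have h1 := congrArg Matrix.trace (mul_res (isHermitian_herm n y) hζ)
  rw [sub_mul, Matrix.trace_sub, smul_mul_assoc, one_mul, Matrix.trace_smul, Matrix.trace_one,
    Fintype.card_fin, smul_eq_mul] at h1
  have h2 : (herm n y * res (herm n y) ζ).trace =
      ∑ i, ∑ j, herm n y i j * res (herm n y) ζ j i := by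
    simp [Matrix.trace, Matrix.mul_apply]
  have h3 : (res (herm n y) ζ).trace ^ 2 =
      ∑ i, ∑ j, res (herm n y) ζ j j * res (herm n y) ζ i i := by
    rw [pow_two, Matrix.trace, Finset.sum_mul_sum, Finset.sum_comm]
    rfl
  rw [h2] at h1
  rw [h3]
  simp only [Finset.sum_sub_distrib]
  linear_combination -h1

lemma norm_sum_res_sq_le (hζ : 0 < ζ.im) (y : InputIndex → ℝ) :
    ‖∑ i, ∑ j, res (herm n y) ζ j i ^ 2‖ ≤ n * ζ.im⁻¹ ^ 2 := by
  refine (norm_sum_le _ _).trans ((Finset.sum_le_card_nsmul _ _ (ζ.im⁻¹ ^ 2)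
    fun i _ => (norm_sum_le _ _).trans ?_).trans (by simp))
  simp only [norm_pow]
  exact sum_norm_sq_col_le (isHermitian_herm n y) hζ i

lemma norm_trace_res_sub_minor_le {k : ℕ} (hkn : k ≤ n) (hζ : 0 < ζ.im) (y : InputIndex → ℝ) :
    ‖(res (herm n y) ζ).trace - (res (herm k y) ζ).trace‖ ≤ (n - k) * ζ.im⁻¹ := by
  induction n, hkn using Nat.le_induction with
  | base => simp
  | succ n hn ih =>
    have h := norm_trace_res_submatrix_sub_le (isHermitian_herm (n + 1) y) hζ
    rw [submatrix_herm] at h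
    refine (norm_sub_le_norm_sub_add_norm_sub _ (res (herm n y) ζ).trace _).trans
      ((add_le_add h ih).trans (le_of_eq ?_))
    push_cast
    ring

lemma continuous_herm (n : ℕ) : Continuous (herm n) := by
  refine continuous_matrix fun i j => ?_
  simp only [herm_apply]
  fun_prop

lemma continuous_res (hζ : 0 < ζ.im) : Continuous fun y => res (herm n y) ζ := by
  have h : Continuous fun y => herm n y - ζ • 1 := (continuous_herm n).sub continuous_const
  simp only [res, Matrix.inv_def, Ring.inverse_eq_inv']
  exact (h.matrix_det.inv₀ fun y => det_sub_smul_one_ne_zero (isHermitian_herm n y) hζ).smul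
    h.matrix_adjugate

lemma continuous_res_apply (hζ : 0 < ζ.im) (i j : Fin n) :
    Continuous fun y => res (herm n y) ζ i j :=
  (continuous_res hζ).matrix_elem i j

lemma continuous_trace_res (hζ : 0 < ζ.im) : Continuous fun y => (res (herm n y) ζ).trace :=
  (continuous_res hζ).matrix_trace

/-! ### The normalized Stieltjes transform -/

/-- The Stieltjes transform at `z` of the empirical spectral distribution of `n^{-1/2} i W̃ₙ`,
expressed by the resolvent of the matrix without normalization. -/
def stieltjes (n : ℕ) (y : InputIndex → ℝ) (z : ℂ) : ℂ :=
  ((Real.sqrt n)⁻¹ : ℝ) * (res (herm n y) (Real.sqrt n * z)).trace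

lemma im_sqrt_mul (n : ℕ) (z : ℂ) : ((Real.sqrt n : ℂ) * z).im = Real.sqrt n * z.im := by
  simp

lemma im_sqrt_mul_pos (hn : 0 < n) {z : ℂ} (hz : 0 < z.im) :
    0 < ((Real.sqrt n : ℂ) * z).im := by
  rw [im_sqrt_mul]
  have : 0 < Real.sqrt n := Real.sqrt_pos.2 (by exact_mod_cast hn)
  positivity

lemma norm_stieltjes_le (hn : 0 < n) {z : ℂ} (hz : 0 < z.im) (y : InputIndex → ℝ) :
    ‖stieltjes n y z‖ ≤ z.im⁻¹ := by
  have hr : 0 < Real.sqrt n := Real.sqrt_pos.2 (by exact_mod_cast hn)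
  have h := norm_trace_res_le (isHermitian_herm n y) (im_sqrt_mul_pos hn hz)
  rw [im_sqrt_mul, Fintype.card_fin] at h
  rw [stieltjes, norm_mul, Complex.norm_real, Real.norm_of_nonneg (by positivity)]
  refine (mul_le_mul_of_nonneg_left h (by positivity)).trans (le_of_eq ?_)
  have : (n : ℝ) = Real.sqrt n * Real.sqrt n := (Real.mul_self_sqrt (by positivity)).symm
  rw [mul_inv]
  nth_rw 2 [this]
  field_simp

lemma im_stieltjes_pos (hn : 0 < n) {z : ℂ} (hz : 0 < z.im) (y : InputIndex → ℝ) :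
    0 < (stieltjes n y z).im := by
  have hr : 0 < Real.sqrt n := Real.sqrt_pos.2 (by exact_mod_cast hn)
  have : Nonempty (Fin n) := ⟨⟨0, hn⟩⟩
  rw [stieltjes, Complex.im_ofReal_mul]
  exact mul_pos (inv_pos.2 hr) (im_trace_res_pos (isHermitian_herm n y) (im_sqrt_mul_pos hn hz))

lemma continuous_stieltjes (hn : 0 < n) {z : ℂ} (hz : 0 < z.im) :
    Continuous fun y => stieltjes n y z :=
  continuous_const.mul (continuous_trace_res (im_sqrt_mul_pos hn hz))

/-- Between consecutive squares the Stieltjes transform varies little, for every array of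
variables: passing from `n` to `k²` removes `O(√n)` rows. -/
lemma norm_stieltjes_sub_le {k : ℕ} (hk : 0 < k) (h1 : k ^ 2 ≤ n) (h2 : n < (k + 1) ^ 2) {z : ℂ}
    (hz : 0 < z.im) (y : InputIndex → ℝ) :
    ‖stieltjes n y z - stieltjes (k ^ 2) y z‖ ≤ (‖z‖ * z.im⁻¹ ^ 2 + 3 * z.im⁻¹) * (k : ℝ)⁻¹ := by
  have hn : 0 < n := lt_of_lt_of_le (by positivity) h1
  have hk' : (0 : ℝ) < k := by exact_mod_cast hk
  set r := Real.sqrt n with hr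
  have hrr : r * r = n := Real.mul_self_sqrt (by positivity)
  have hkr : (k : ℝ) ≤ r := Real.le_sqrt_of_sq_le (by exact_mod_cast h1)
  have hr0 : 0 < r := hk'.trans_le hkr
  have hrk : r ≤ k + 1 := by
    rw [hr, Real.sqrt_le_left (by positivity)]
    exact_mod_cast h2.le
  have hkk : Real.sqrt ((k ^ 2 : ℕ) : ℝ) = k := by
    push_cast
    exact Real.sqrt_sq hk'.le
  have hζ1 : 0 < ((r : ℂ) * z).im := im_sqrt_mul_pos hn hz
  have hi2 : ((k : ℝ) * z : ℂ).im = k * z.im := by simp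
  have hζ2 : 0 < ((k : ℝ) * z : ℂ).im := by
    rw [hi2]
    positivity
  have hi1 : ((r : ℂ) * z).im = r * z.im := im_sqrt_mul n z
  have b1 := norm_trace_res_sub_le (isHermitian_herm n y) hζ1 hζ2
  have b2 := norm_trace_res_sub_minor_le h1 hζ2 y
  have b3 := norm_trace_res_le (isHermitian_herm (k ^ 2) y) hζ2
  rw [hi2] at b1 b2 b3
  rw [hi1, ← sub_mul, norm_mul, ← Complex.ofReal_sub, Complex.norm_real,
    Real.norm_of_nonneg (sub_nonneg.2 hkr), Fintype.card_fin] at b1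
  rw [Fintype.card_fin] at b3
  simp only [stieltjes, hkk]
  rw [← hr]
  set A := (res (herm n y) (r * z)).trace
  set B := (res (herm n y) ((k : ℝ) * z)).trace
  set D := (res (herm (k ^ 2) y) ((k : ℝ) * z)).trace
  -- Change the spectral parameter, then the size, then the normalization.
  have e : ((r⁻¹ : ℝ) : ℂ) * A - (((k : ℝ)⁻¹ : ℝ) : ℂ) * D =
      ((r⁻¹ : ℝ) : ℂ) * (A - B) + ((r⁻¹ : ℝ) : ℂ) * (B - D) -
        ((((k : ℝ)⁻¹ - r⁻¹ : ℝ)) : ℂ) * D := by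
    push_cast
    ring
  have hinv : r⁻¹ ≤ (k : ℝ)⁻¹ := inv_anti₀ hk' hkr
  rw [e]
  refine (norm_sub_le _ _).trans ((add_le_add_left (norm_add_le _ _) _).trans ?_)
  simp only [norm_mul, Complex.norm_real]
  rw [Real.norm_of_nonneg (inv_nonneg.2 hr0.le), Real.norm_of_nonneg (sub_nonneg.2 hinv)]
  have c1 : r⁻¹ * ‖A - B‖ ≤ ‖z‖ * z.im⁻¹ ^ 2 * (k : ℝ)⁻¹ := by
    calc r⁻¹ * ‖A - B‖ ≤ r⁻¹ * (n * (1 * ‖z‖ * ((r * z.im)⁻¹ * (k * z.im)⁻¹))) := by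
          refine mul_le_mul_of_nonneg_left (b1.trans ?_) (by positivity)
          gcongr
          linarith
      _ = _ := by
          rw [← hrr]
          field_simp
  have c2 : r⁻¹ * ‖B - D‖ ≤ 2 * z.im⁻¹ * (k : ℝ)⁻¹ := by
    have hnk : (n : ℝ) - (k ^ 2 : ℕ) ≤ 2 * k := by
      have : n ≤ k ^ 2 + 2 * k := by
        have : (k + 1) ^ 2 = k ^ 2 + 2 * k + 1 := by ring
        omega
      have h' : (n : ℝ) ≤ (k ^ 2 : ℕ) + 2 * k := by exact_mod_cast this
      linarith
    calc r⁻¹ * ‖B - D‖ ≤ (k : ℝ)⁻¹ * (2 * k * (k * z.im)⁻¹) := by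
          gcongr
          refine b2.trans ?_
          gcongr
      _ = _ := by field_simp
  have c3 : ((k : ℝ)⁻¹ - r⁻¹) * ‖D‖ ≤ z.im⁻¹ * (k : ℝ)⁻¹ := by
    have hdiff : (k : ℝ)⁻¹ - r⁻¹ ≤ (k : ℝ)⁻¹ * (k : ℝ)⁻¹ := by
      calc (k : ℝ)⁻¹ - r⁻¹ = (r - k) * ((k : ℝ)⁻¹ * r⁻¹) := by field_simp
        _ ≤ 1 * ((k : ℝ)⁻¹ * (k : ℝ)⁻¹) := by
          gcongr
          linarith
        _ = _ := one_mul _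
    calc ((k : ℝ)⁻¹ - r⁻¹) * ‖D‖
        ≤ (k : ℝ)⁻¹ * (k : ℝ)⁻¹ * (((k ^ 2 : ℕ) : ℝ) * (k * z.im)⁻¹) :=
          mul_le_mul hdiff b3 (norm_nonneg _) (by positivity)
      _ = _ := by
          push_cast
          field_simp
  linarith

/-! ### The self-consistent equation in mean -/

section Mean

variable {Ω : Type*} [MeasurableSpace Ω] {P : Measure Ω} {x : InputIndex → Ω → ℝ}
  {n : ℕ} {ζ z : ℂ}

lemma IndepStandardized.integrable_sq (h : IndepStandardized x P) (p : InputIndex) :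
    Integrable (fun ω => x p ω ^ 2) P := (h.memLp p).integrable_sq

lemma measurable_family (h : IndepStandardized x P) : Measurable fun ω => (fun q => x q ω) :=
  measurable_pi_lambda _ h.measurable

lemma IndepStandardized.measurable_update (h : IndepStandardized x P) (p : InputIndex) :
    Measurable fun ω => Function.update (fun q => x q ω) p 0 :=
  measurable_update_left.comp (measurable_family h)

lemma IndepStandardized.integrable_sq_mul_min (h : IndepStandardized x P) (p : InputIndex) {a : ℝ}
    (ha : 0 ≤ a) : Integrable (fun ω => x p ω ^ 2 * min 1 (|x p ω| * a)) P := by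
  have hm := h.measurable p
  refine (h.integrable_sq p).mono' (by fun_prop) (ae_of_all _ fun ω => ?_)
  have : 0 ≤ min 1 (|x p ω| * a) := le_min zero_le_one (by positivity)
  rw [Real.norm_of_nonneg (by positivity)]
  exact mul_le_of_le_one_right (sq_nonneg _) (min_le_left _ _)

variable [IsProbabilityMeasure P]

lemma IndepStandardized.integrable (h : IndepStandardized x P) (p : InputIndex) :
    Integrable (x p) P := (h.memLp p).integrable one_le_two

lemma IndepStandardized.integral_sq (h : IndepStandardized x P) (p : InputIndex) :
    ∫ ω, x p ω ^ 2 ∂P = 1 := by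
  have h1 := variance_eq_sub (h.memLp p)
  rw [h.variance, h.mean] at h1
  simpa using h1.symm

lemma IndepStandardized.integral_abs_le (h : IndepStandardized x P) (p : InputIndex) :
    ∫ ω, |x p ω| ∂P ≤ 1 := by
  have h1 : ∫ ω, |x p ω| ∂P ≤ ∫ ω, (1 / 2 + 1 / 2 * x p ω ^ 2) ∂P :=
    integral_mono (h.integrable p).abs
      ((integrable_const _).add ((h.integrable_sq p).const_mul _)) fun ω => by
        have : |x p ω| ^ 2 = x p ω ^ 2 := sq_abs _
        show |x p ω| ≤ 1 / 2 + 1 / 2 * x p ω ^ 2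
        nlinarith [sq_nonneg (|x p ω| - 1)]
  refine h1.trans (le_of_eq ?_)
  rw [integral_add (integrable_const _) ((h.integrable_sq p).const_mul _), integral_const_mul,
    h.integral_sq]
  simp
  norm_num

lemma IndepStandardized.integrable_herm_mul_res (h : IndepStandardized x P) (hζ : 0 < ζ.im)
    {i j : Fin n} (hij : i ≠ j) :
    Integrable (fun ω => herm n (fun q => x q ω) i j * res (herm n fun q => x q ω) ζ j i) P := by
  have hc : Continuous fun y => herm n y i j * res (herm n y) ζ j i :=
    ((continuous_herm n).matrix_elem i j).mul (continuous_res_apply hζ j i)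
  refine ((h.integrable (wignerLink i j)).abs.mul_const ζ.im⁻¹).mono'
    (hc.measurable.comp (measurable_pi_lambda _ h.measurable)).aestronglyMeasurable
    (ae_of_all _ fun ω => ?_)
  rw [norm_mul, norm_herm hij]
  exact mul_le_mul_of_nonneg_left (norm_res_le (isHermitian_herm _ _) hζ j i) (abs_nonneg _)

lemma continuous_quadratic (hζ : 0 < ζ.im) (i j : Fin n) : Continuous fun y =>
    res (herm n y) ζ j i ^ 2 - res (herm n y) ζ j j * res (herm n y) ζ i i :=
  ((continuous_res_apply hζ j i).pow 2).sub
    ((continuous_res_apply hζ j j).mul (continuous_res_apply hζ i i))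

lemma norm_quadratic_le (hζ : 0 < ζ.im) (i j : Fin n) (y : InputIndex → ℝ) :
    ‖res (herm n y) ζ j i ^ 2 - res (herm n y) ζ j j * res (herm n y) ζ i i‖ ≤
      2 * ζ.im⁻¹ ^ 2 := by
  have h := norm_res_le (isHermitian_herm n y) hζ
  have hN : 0 ≤ ζ.im⁻¹ := by positivity
  refine (norm_sub_le _ _).trans ?_
  rw [norm_pow, norm_mul]
  have h1 := pow_le_pow_left₀ (norm_nonneg _) (h j i) 2
  have h2 := mul_le_mul (h j j) (h i i) (norm_nonneg _) hN
  linarith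

/-- The independence of `x p` from the matrix in which `x p` is replaced by `0` gives the leading
term of the expectation of `Hᵢⱼ Rⱼᵢ`, with an error controlled without moments of higher order. -/
lemma IndepStandardized.norm_integral_entry_le (h : IndepStandardized x P) (hζ : 0 < ζ.im)
    {φ : ℝ} (hφ : ∀ p, ∫ ω, x p ω ^ 2 * min 1 (|x p ω| * ζ.im⁻¹) ∂P ≤ φ)
    {i j : Fin n} (hij : i ≠ j) :
    ‖∫ ω, (herm n (fun q => x q ω) i j * res (herm n fun q => x q ω) ζ j i -
      (res (herm n fun q => x q ω) ζ j i ^ 2 -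
        res (herm n fun q => x q ω) ζ j j * res (herm n fun q => x q ω) ζ i i)) ∂P‖ ≤
      4 * ζ.im⁻¹ ^ 2 * φ + 8 * ζ.im⁻¹ ^ 3 := by
  have hN : 0 ≤ ζ.im⁻¹ := by positivity
  set p := wignerLink i j with hp
  set X : Ω → InputIndex → ℝ := fun ω q => x q ω with hX
  have hXm : Measurable X := measurable_pi_lambda _ h.measurable
  let Y : Ω → InputIndex → ℝ := fun ω => Function.update (X ω) p 0
  have hYm : Measurable Y := h.measurable_update p
  let Q : (InputIndex → ℝ) → ℂ := fun y =>
    res (herm n y) ζ j i ^ 2 - res (herm n y) ζ j j * res (herm n y) ζ i i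
  have hQc : Continuous Q := continuous_quadratic hζ i j
  have hQb : ∀ y, ‖Q y‖ ≤ 2 * ζ.im⁻¹ ^ 2 := norm_quadratic_le hζ i j
  have hRc : Continuous fun y => res (herm n y) ζ j i := continuous_res_apply hζ j i
  let F : Ω → ℂ := fun ω => herm n (X ω) i j * res (herm n (X ω)) ζ j i
  let A : Ω → ℂ := fun ω => herm n (X ω) i j * res (herm n (Y ω)) ζ j i
  let B : Ω → ℂ := fun ω => ((x p ω ^ 2 : ℝ) : ℂ) * Q (Y ω)
  have hind : IndepFun (x p) Y P := (indepFun_update_zero h.measurable h.indep p).symm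
  have hFi : Integrable F P := h.integrable_herm_mul_res hζ hij
  have hhm : Measurable fun ω => herm n (X ω) i j :=
    (((continuous_herm n).matrix_elem i j).measurable).comp hXm
  have hAi : Integrable A P := by
    refine ((h.integrable p).abs.mul_const ζ.im⁻¹).mono'
      (hhm.mul (hRc.measurable.comp hYm)).aestronglyMeasurable (ae_of_all _ fun ω => ?_)
    rw [norm_mul, norm_herm hij]
    exact mul_le_mul_of_nonneg_left (norm_res_le (isHermitian_herm _ _) hζ j i) (abs_nonneg _)
  have hBi : Integrable B P := by
    have hpm := h.measurable p
    refine ((h.integrable_sq p).mul_const (2 * ζ.im⁻¹ ^ 2)).mono' (Measurable.aestronglyMeasurable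
      ((by fun_prop : Measurable fun ω => ((x p ω ^ 2 : ℝ) : ℂ)).mul (hQc.measurable.comp hYm)))
      (ae_of_all _ fun ω => ?_)
    rw [norm_mul, Complex.norm_real, Real.norm_of_nonneg (sq_nonneg _)]
    exact mul_le_mul_of_nonneg_left (hQb _) (sq_nonneg _)
  have hQX : Integrable (fun ω => Q (X ω)) P :=
    .of_bound (hQc.measurable.comp hXm).aestronglyMeasurable _ (ae_of_all _ fun ω => hQb _)
  have hQY : Integrable (fun ω => Q (Y ω)) P :=
    .of_bound (hQc.measurable.comp hYm).aestronglyMeasurable _ (ae_of_all _ fun ω => hQb _)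
  have hA0 : ∫ ω, A ω ∂P = 0 := by
    have h1 := hind.integral_fun_comp_mul_comp (f := fun t : ℝ => Complex.I * (sgn i j * t : ℝ))
      (g := fun y => res (herm n y) ζ j i) (h.measurable p).aemeasurable hYm.aemeasurable
      (by fun_prop) hRc.aestronglyMeasurable
    have h2 : ∫ ω, Complex.I * ((sgn i j * x p ω : ℝ) : ℂ) ∂P = 0 := by
      rw [integral_const_mul, integral_complex_ofReal, integral_const_mul, h.mean]
      simp
    rw [h2, zero_mul] at h1
    exact h1
  have hB0 : ∫ ω, B ω ∂P = ∫ ω, Q (Y ω) ∂P := by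
    have h1 := hind.integral_fun_comp_mul_comp (f := fun t : ℝ => ((t ^ 2 : ℝ) : ℂ)) (g := Q)
      (h.measurable p).aemeasurable hYm.aemeasurable (by fun_prop) hQc.aestronglyMeasurable
    have h2 : ∫ ω, ((x p ω ^ 2 : ℝ) : ℂ) ∂P = 1 := by
      rw [integral_complex_ofReal, h.integral_sq, Complex.ofReal_one]
    rw [h2, one_mul] at h1
    exact h1
  have hdec : ∫ ω, (F ω - Q (X ω)) ∂P =
      ∫ ω, (F ω - (A ω + B ω)) ∂P + ∫ ω, (Q (Y ω) - Q (X ω)) ∂P := by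
    have hABi : Integrable (fun ω => A ω + B ω) P := hAi.add hBi
    rw [integral_sub hFi hQX, integral_sub hFi hABi, integral_sub hQY hQX,
      integral_add hAi hBi, hA0, hB0]
    ring
  have b1 : ‖∫ ω, (F ω - (A ω + B ω)) ∂P‖ ≤ 4 * ζ.im⁻¹ ^ 2 * φ := by
    refine (norm_integral_le_of_norm_le ((h.integrable_sq_mul_min p hN).const_mul
      (4 * ζ.im⁻¹ ^ 2)) (ae_of_all _ fun ω => ?_)).trans ?_
    · exact norm_herm_mul_res_sub_le hij hζ (X ω)
    · rw [integral_const_mul]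
      exact mul_le_mul_of_nonneg_left (hφ p) (by positivity)
  have b2 : ‖∫ ω, (Q (Y ω) - Q (X ω)) ∂P‖ ≤ 8 * ζ.im⁻¹ ^ 3 := by
    refine (norm_integral_le_of_norm_le ((h.integrable p).abs.const_mul
      (8 * ζ.im⁻¹ ^ 3)) (ae_of_all _ fun ω => ?_)).trans ?_
    · exact norm_res_quadratic_sub_le hij hζ (X ω)
    · rw [integral_const_mul]
      exact mul_le_of_le_one_right (by positivity) (h.integral_abs_le p)
  change ‖∫ ω, (F ω - Q (X ω)) ∂P‖ ≤ _
  rw [hdec]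
  exact (norm_add_le _ _).trans (add_le_add b1 b2)

lemma IndepStandardized.norm_integral_trace_equation_le (h : IndepStandardized x P)
    (hζ : 0 < ζ.im) {φ : ℝ} (hφ : ∀ p, ∫ ω, x p ω ^ 2 * min 1 (|x p ω| * ζ.im⁻¹) ∂P ≤ φ) :
    ‖∫ ω, ((n : ℂ) + ζ * (res (herm n fun q => x q ω) ζ).trace +
      (res (herm n fun q => x q ω) ζ).trace ^ 2) ∂P‖ ≤
      n * (n * (4 * ζ.im⁻¹ ^ 2 * φ + 8 * ζ.im⁻¹ ^ 3)) + n * ζ.im⁻¹ ^ 2 := by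
  have hN : 0 ≤ ζ.im⁻¹ := by positivity
  have hφ0 : 0 ≤ φ := by
    refine (integral_nonneg fun ω => ?_).trans (hφ ⟨(0, 0), le_rfl⟩)
    exact mul_nonneg (sq_nonneg _) (le_min zero_le_one (by positivity))
  have hXm : Measurable fun ω => (fun q => x q ω) := measurable_pi_lambda _ h.measurable
  simp only [trace_equation hζ]
  set D : Fin n → Fin n → Ω → ℂ := fun i j ω =>
    herm n (fun q => x q ω) i j * res (herm n fun q => x q ω) ζ j i -
      (res (herm n fun q => x q ω) ζ j i ^ 2 -
        res (herm n fun q => x q ω) ζ j j * res (herm n fun q => x q ω) ζ i i) with hD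
  have hdiag : ∀ i, D i i = 0 := by
    intro i
    funext ω
    simp only [hD, herm_diag, Pi.zero_apply]
    ring
  have hDi : ∀ i j, Integrable (D i j) P := by
    intro i j
    by_cases hij : i = j
    · subst hij
      rw [hdiag]
      exact integrable_zero _ _ _
    · exact (h.integrable_herm_mul_res hζ hij).sub
        (.of_bound ((continuous_quadratic hζ i j).measurable.comp hXm).aestronglyMeasurable _
          (ae_of_all _ fun ω => norm_quadratic_le hζ i j _))
  have hDb : ∀ i j, ‖∫ ω, D i j ω ∂P‖ ≤ 4 * ζ.im⁻¹ ^ 2 * φ + 8 * ζ.im⁻¹ ^ 3 := by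
    intro i j
    by_cases hij : i = j
    · subst hij
      rw [hdiag]
      simp
      positivity
    · exact h.norm_integral_entry_le hζ hφ hij
  have hsc : Continuous fun y => ∑ i, ∑ j, res (herm n y) ζ j i ^ 2 :=
    continuous_finsetSum _ fun i _ => continuous_finsetSum _ fun j _ =>
      (continuous_res_apply hζ j i).pow 2
  have hsi : Integrable (fun ω => ∑ i, ∑ j, res (herm n fun q => x q ω) ζ j i ^ 2) P :=
    .of_bound (hsc.measurable.comp hXm).aestronglyMeasurable _
      (ae_of_all _ fun ω => norm_sum_res_sq_le hζ _)
  rw [integral_add (integrable_finsetSum _ fun i _ => integrable_finsetSum _ fun j _ => hDi i j)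
    hsi]
  refine (norm_add_le _ _).trans (add_le_add ?_ ?_)
  · rw [integral_finsetSum _ fun i _ => integrable_finsetSum _ fun j _ => hDi i j]
    refine (norm_sum_le _ _).trans ((Finset.sum_le_card_nsmul _ _
      (n * (4 * ζ.im⁻¹ ^ 2 * φ + 8 * ζ.im⁻¹ ^ 3)) fun i _ => ?_).trans (by simp))
    rw [integral_finsetSum _ fun j _ => hDi i j]
    exact (norm_sum_le _ _).trans ((Finset.sum_le_card_nsmul _ _ _ fun j _ => hDb i j).trans
      (by rw [Finset.card_univ, Fintype.card_fin, nsmul_eq_mul]))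
  · have := norm_integral_le_of_norm_le_const (μ := P) (ae_of_all _ fun ω =>
      norm_sum_res_sq_le (n := n) hζ fun q => x q ω)
    simpa using this

lemma stieltjes_equation (hn : 0 < n) (y : InputIndex → ℝ) :
    1 + z * stieltjes n y z + stieltjes n y z ^ 2 =
      (n : ℂ)⁻¹ * ((n : ℂ) + Real.sqrt n * z * (res (herm n y) (Real.sqrt n * z)).trace +
        (res (herm n y) (Real.sqrt n * z)).trace ^ 2) := by
  have hr : (Real.sqrt n : ℂ) ≠ 0 := by
    have : 0 < Real.sqrt n := Real.sqrt_pos.2 (by exact_mod_cast hn)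
    exact_mod_cast this.ne'
  have hrr : (n : ℂ) = (Real.sqrt n : ℂ) ^ 2 := by
    rw [← Complex.ofReal_pow, Real.sq_sqrt (by positivity), Complex.ofReal_natCast]
  rw [stieltjes, hrr]
  push_cast
  generalize (Real.sqrt n : ℂ) = r at *
  field_simp

lemma IndepStandardized.norm_integral_stieltjes_equation_le (h : IndepStandardized x P)
    (hn : 0 < n) (hz : 0 < z.im) {φ : ℝ}
    (hφ : ∀ p, ∫ ω, x p ω ^ 2 * min 1 (|x p ω| * (Real.sqrt n * z.im)⁻¹) ∂P ≤ φ) :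
    ‖∫ ω, (1 + z * stieltjes n (fun q => x q ω) z + stieltjes n (fun q => x q ω) z ^ 2) ∂P‖ ≤
      4 * z.im⁻¹ ^ 2 * φ + 8 * z.im⁻¹ ^ 3 * (Real.sqrt n)⁻¹ + z.im⁻¹ ^ 2 * (n : ℝ)⁻¹ := by
  have hr : 0 < Real.sqrt n := Real.sqrt_pos.2 (by exact_mod_cast hn)
  have hrr : (n : ℝ) = Real.sqrt n ^ 2 := (Real.sq_sqrt (by positivity)).symm
  rw [← im_sqrt_mul] at hφ
  have h1 := h.norm_integral_trace_equation_le (n := n) (im_sqrt_mul_pos hn hz) hφ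
  simp only [stieltjes_equation hn]
  rw [integral_const_mul, norm_mul, norm_inv, Complex.norm_natCast]
  rw [im_sqrt_mul] at h1
  refine (mul_le_mul_of_nonneg_left h1 (by positivity)).trans (le_of_eq ?_)
  generalize Real.sqrt n = r at *
  rw [hrr]
  field_simp

lemma dependsOn_herm (n : ℕ) : DependsOn (herm n)
    ((Finset.univ.image fun ij : Fin n × Fin n => wignerLink ij.1 ij.2 : Finset InputIndex) :
      Set InputIndex) := by
  intro y y' hy
  ext i j
  rw [herm_apply, herm_apply, hy _ (by simp)]

/-- The variance of the Stieltjes transform is of order `1/n`. -/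
lemma IndepStandardized.integral_norm_stieltjes_sub_sq_le (h : IndepStandardized x P)
    (hn : 0 < n) (hz : 0 < z.im) :
    ∫ ω, ‖stieltjes n (fun q => x q ω) z - ∫ ω', stieltjes n (fun q => x q ω') z ∂P‖ ^ 2 ∂P ≤
      8 * z.im⁻¹ ^ 4 * (n : ℝ)⁻¹ := by
  have hr : 0 < Real.sqrt n := Real.sqrt_pos.2 (by exact_mod_cast hn)
  have hrr : (n : ℝ) = Real.sqrt n ^ 2 := (Real.sq_sqrt (by positivity)).symm
  have hXm : Measurable fun ω => (fun q => x q ω) := measurable_pi_lambda _ h.measurable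
  have hsc := continuous_stieltjes hn hz
  have hsi : Integrable (fun ω => stieltjes n (fun q => x q ω) z) P :=
    .of_bound (hsc.measurable.comp hXm).aestronglyMeasurable _
      (ae_of_all _ fun ω => norm_stieltjes_le hn hz _)
  set S : Finset InputIndex := Finset.univ.image fun ij : Fin n × Fin n => wignerLink ij.1 ij.2
  have hS : (S.card : ℝ) ≤ n ^ 2 := by
    have : S.card ≤ n * n := Finset.card_image_le.trans (by simp)
    rw [pow_two]
    exact_mod_cast this
  have hdiff : ∀ (y : InputIndex → ℝ), ∀ p ∈ S,
      ‖stieltjes n y z - stieltjes n (Function.update y p 0) z‖ ≤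
        2 * z.im⁻¹ ^ 2 * (Real.sqrt n)⁻¹ ^ 3 * |y p| := by
    intro y p hp
    obtain ⟨ij, -, rfl⟩ := Finset.mem_image.1 hp
    have h1 := norm_trace_res_sub_update_le (im_sqrt_mul_pos hn hz) y ij.1 ij.2
    rw [stieltjes, stieltjes, ← mul_sub, norm_mul, Complex.norm_real,
      Real.norm_of_nonneg (by positivity)]
    refine (mul_le_mul_of_nonneg_left h1 (by positivity)).trans (le_of_eq ?_)
    rw [im_sqrt_mul, mul_inv]
    ring
  have key : ∀ L : ℂ →ₗ[ℝ] ℝ, Continuous L → (∀ c, |L c| ≤ ‖c‖) →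
      ∫ ω, (L (stieltjes n (fun q => x q ω) z) -
        ∫ ω', L (stieltjes n (fun q => x q ω') z) ∂P) ^ 2 ∂P ≤ 4 * z.im⁻¹ ^ 4 * (n : ℝ)⁻¹ := by
    intro L hLc hL
    have h1 := variance_le_sum_update_zero (f := fun y => L (stieltjes n y z)) (C := z.im⁻¹)
      h.measurable h.indep S (hLc.comp hsc).measurable
      (fun y => (hL _).trans (norm_stieltjes_le hn hz y))
      (fun y y' hy => by simp only [stieltjes, dependsOn_herm n hy])
    refine h1.trans ((Finset.sum_le_card_nsmul S _
      ((2 * z.im⁻¹ ^ 2 * (Real.sqrt n)⁻¹ ^ 3) ^ 2) fun p hp => ?_).trans ?_)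
    · have h2 : ∫ ω, (2 * z.im⁻¹ ^ 2 * (Real.sqrt n)⁻¹ ^ 3) ^ 2 * x p ω ^ 2 ∂P =
          (2 * z.im⁻¹ ^ 2 * (Real.sqrt n)⁻¹ ^ 3) ^ 2 := by
        rw [integral_const_mul, h.integral_sq, mul_one]
      rw [← h2]
      refine integral_mono_of_nonneg (ae_of_all _ fun ω => sq_nonneg _)
        ((h.integrable_sq p).const_mul _) (ae_of_all _ fun ω => ?_)
      show _ ≤ (2 * z.im⁻¹ ^ 2 * (Real.sqrt n)⁻¹ ^ 3) ^ 2 * x p ω ^ 2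
      rw [← mul_pow, sq_le_sq, ← map_sub]
      refine (hL _).trans ((hdiff _ p hp).trans (le_of_eq ?_))
      rw [abs_mul, abs_of_nonneg (by positivity : 0 ≤ 2 * z.im⁻¹ ^ 2 * (Real.sqrt n)⁻¹ ^ 3)]
    · rw [nsmul_eq_mul]
      refine (mul_le_mul_of_nonneg_right hS (by positivity)).trans (le_of_eq ?_)
      rw [hrr]
      field_simp
      norm_num
  have hre := key Complex.reLm Complex.continuous_re Complex.abs_re_le_norm
  have him := key Complex.imLm Complex.continuous_im Complex.abs_im_le_norm
  simp only [Complex.reLm_coe, Complex.imLm_coe] at hre him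
  have hmre : ∫ ω, (stieltjes n (fun q => x q ω) z).re ∂P =
      (∫ ω, stieltjes n (fun q => x q ω) z ∂P).re := integral_re hsi
  have hmim : ∫ ω, (stieltjes n (fun q => x q ω) z).im ∂P =
      (∫ ω, stieltjes n (fun q => x q ω) z ∂P).im := integral_im hsi
  rw [hmre] at hre
  rw [hmim] at him
  set m := ∫ ω, stieltjes n (fun q => x q ω) z ∂P
  have hint : ∀ L : ℂ → ℝ, Continuous L → (∀ c, |L c| ≤ ‖c‖) →
      Integrable (fun ω => L (stieltjes n (fun q => x q ω) z - m) ^ 2) P := by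
    intro L hLc hL
    refine .of_bound (((hLc.comp (hsc.sub continuous_const)).pow 2).measurable.comp
      hXm).aestronglyMeasurable ((z.im⁻¹ + ‖m‖) ^ 2) (ae_of_all _ fun ω => ?_)
    rw [norm_pow]
    exact pow_le_pow_left₀ (norm_nonneg _) ((hL _).trans ((norm_sub_le _ _).trans
      (add_le_add (norm_stieltjes_le hn hz _) le_rfl))) 2
  have hsplit : ∀ c : ℂ, ‖c‖ ^ 2 = c.re ^ 2 + c.im ^ 2 := fun c => by
    rw [← Complex.normSq_eq_norm_sq, Complex.normSq_apply]
    ring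
  simp only [hsplit]
  rw [integral_add (hint _ Complex.continuous_re Complex.abs_re_le_norm)
    (hint _ Complex.continuous_im Complex.abs_im_le_norm)]
  simp only [Complex.sub_re, Complex.sub_im]
  linarith

end Mean

/-! ### Almost sure convergence of the Stieltjes transform -/

/-- The functions `x p ^ 2` are uniformly integrable, in a form which involves no truncation. -/
def UniformlySquareIntegrable {Ω : Type*} [MeasurableSpace Ω] (x : InputIndex → Ω → ℝ)
    (P : Measure Ω) : Prop :=
  ∀ ε > 0, ∃ K : ℝ, ∀ N ≥ K, 0 < N → ∀ p, ∫ ω, x p ω ^ 2 * min 1 (|x p ω| * N⁻¹) ∂P ≤ ε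

section AlmostSure

variable {Ω : Type*} [MeasurableSpace Ω] {P : Measure Ω} {x : InputIndex → Ω → ℝ} {z : ℂ}

lemma UniformlySquareIntegrable.of_le {C : ℝ}
    (h : ∀ p, ∀ N : ℝ, 0 < N → ∫ ω, x p ω ^ 2 * min 1 (|x p ω| * N⁻¹) ∂P ≤ C * N⁻¹) :
    UniformlySquareIntegrable x P := by
  intro ε hε
  have ht : Tendsto (fun N : ℝ => C * N⁻¹) atTop (𝓝 0) := by
    simpa using tendsto_inv_atTop_zero.const_mul C
  obtain ⟨K, hK⟩ := eventually_atTop.1 (ht.eventually (ge_mem_nhds hε))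
  exact ⟨K, fun N hN hN0 p => (h p N hN0).trans (hK N hN)⟩

/-- If the expectations of nonnegative functions are summable, the functions tend to zero almost
surely. -/
lemma ae_tendsto_zero_of_summable_integral {f : ℕ → Ω → ℝ} (hf : ∀ k, Integrable (f k) P)
    (h0 : ∀ k ω, 0 ≤ f k ω) (hs : Summable fun k => ∫ ω, f k ω ∂P) :
    ∀ᵐ ω ∂P, Tendsto (fun k => f k ω) atTop (𝓝 0) := by
  have h1 : ∫⁻ ω, ∑' k, ENNReal.ofReal (f k ω) ∂P ≠ ⊤ := by
    rw [lintegral_tsum fun k => (hf k).1.aemeasurable.ennreal_ofReal]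
    simp only [← ofReal_integral_eq_lintegral_ofReal (hf _) (ae_of_all _ (h0 _))]
    exact hs.tsum_ofReal_ne_top
  filter_upwards [ae_lt_top' (AEMeasurable.tsum fun k =>
    (hf k).1.aemeasurable.ennreal_ofReal) h1] with ω hω
  have h2 := ENNReal.tendsto_atTop_zero_of_tsum_ne_top hω.ne
  have h3 := (ENNReal.tendsto_toReal ENNReal.zero_ne_top).comp h2
  simpa [Function.comp_def, ENNReal.toReal_ofReal (h0 _ _)] using h3

lemma AssumptionA2.uniformlySquareIntegrable (h : AssumptionA2 x P) :
    UniformlySquareIntegrable x P := by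
  obtain ⟨h, hid⟩ := h
  let p₀ : InputIndex := ⟨(0, 0), le_rfl⟩
  have hm := h.measurable p₀
  have ht : Tendsto (fun N : ℝ => ∫ ω, x p₀ ω ^ 2 * min 1 (|x p₀ ω| * N⁻¹) ∂P) atTop (𝓝 0) := by
    have h0 : (0 : ℝ) = ∫ _, 0 ∂P := by simp
    rw [h0]
    refine tendsto_integral_filter_of_dominated_convergence (fun ω => x p₀ ω ^ 2)
      (Eventually.of_forall fun N => by fun_prop) ?_ (h.integrable_sq p₀) (ae_of_all _ fun ω => ?_)
    · filter_upwards [eventually_gt_atTop 0] with N hN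
      refine ae_of_all _ fun ω => ?_
      have : 0 ≤ min 1 (|x p₀ ω| * N⁻¹) := le_min zero_le_one (by positivity)
      rw [Real.norm_of_nonneg (by positivity)]
      exact mul_le_of_le_one_right (sq_nonneg _) (min_le_left _ _)
    · have h1 : Tendsto (fun N : ℝ => |x p₀ ω| * N⁻¹) atTop (𝓝 0) := by
        simpa using tendsto_inv_atTop_zero.const_mul |x p₀ ω|
      simpa using ((tendsto_const_nhds (x := (1 : ℝ))).min h1).const_mul (x p₀ ω ^ 2)
  intro ε hε
  obtain ⟨K, hK⟩ := eventually_atTop.1 (ht.eventually (ge_mem_nhds hε))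
  refine ⟨K, fun N hN _ p => le_of_eq_of_le ?_ (hK N hN)⟩
  have hf : Measurable fun t : ℝ => t ^ 2 * min 1 (|t| * N⁻¹) := by fun_prop
  exact ((hid p p₀).comp hf).integral_eq

lemma AssumptionA3.uniformlySquareIntegrable (h : AssumptionA3 x P) :
    UniformlySquareIntegrable x P := by
  obtain ⟨h, hr⟩ := h
  obtain ⟨C, hC⟩ := hr 3
  refine .of_le (C := C) fun p N hN => ?_
  refine (integral_mono (h.integrable_sq_mul_min p (by positivity)) ((hC p).1.mul_const N⁻¹)
    fun ω => ?_).trans ?_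
  · show x p ω ^ 2 * min 1 (|x p ω| * N⁻¹) ≤ |x p ω| ^ 3 * N⁻¹
    rw [← sq_abs (x p ω), pow_succ _ 2, mul_assoc]
    exact mul_le_mul_of_nonneg_left (min_le_right _ _) (sq_nonneg _)
  · rw [integral_mul_const]
    exact mul_le_mul_of_nonneg_right (hC p).2 (by positivity)

variable [IsProbabilityMeasure P]

lemma AssumptionA1.uniformlySquareIntegrable (h : AssumptionA1 x P) :
    UniformlySquareIntegrable x P := by
  obtain ⟨h, C, hC⟩ := h
  refine .of_le (C := C) fun p N hN => ?_
  have e : ∫ ω, x p ω ^ 2 * (C * N⁻¹) ∂P = C * N⁻¹ := by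
    rw [integral_mul_const, h.integral_sq, one_mul]
  rw [← e]
  refine integral_mono_ae (h.integrable_sq_mul_min p (by positivity))
    ((h.integrable_sq p).mul_const _) ?_
  filter_upwards [hC p] with ω hω
  refine mul_le_mul_of_nonneg_left ((min_le_right _ _).trans ?_) (sq_nonneg _)
  gcongr

lemma tendsto_sqrt_natCast : Tendsto (fun n : ℕ => Real.sqrt n) atTop atTop :=
  Real.tendsto_sqrt_atTop.comp tendsto_natCast_atTop_atTop

lemma IndepStandardized.integrable_stieltjes (h : IndepStandardized x P) {n : ℕ} (hn : 0 < n)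
    (hz : 0 < z.im) : Integrable (fun ω => stieltjes n (fun q => x q ω) z) P :=
  .of_bound ((continuous_stieltjes hn hz).measurable.comp
    (measurable_family h)).aestronglyMeasurable _ (ae_of_all _ fun _ => norm_stieltjes_le hn hz _)

lemma IndepStandardized.integrable_norm_stieltjes_sub_sq (h : IndepStandardized x P) {n : ℕ}
    (hn : 0 < n) (hz : 0 < z.im) (m : ℂ) :
    Integrable (fun ω => ‖stieltjes n (fun q => x q ω) z - m‖ ^ 2) P := by
  have hc := ((continuous_stieltjes hn hz).sub (continuous_const (y := m))).norm.pow 2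
  refine .of_bound (hc.measurable.comp (measurable_family h)).aestronglyMeasurable
    ((z.im⁻¹ + ‖m‖) ^ 2) (ae_of_all _ fun ω => ?_)
  rw [norm_pow, norm_norm]
  exact pow_le_pow_left₀ (norm_nonneg _) ((norm_sub_le _ _).trans
    (add_le_add (norm_stieltjes_le hn hz _) le_rfl)) 2

/-- The mean of the Stieltjes transform solves the self-consistent equation in the limit. -/
lemma IndepStandardized.tendsto_integral_stieltjes (h : IndepStandardized x P)
    (hu : UniformlySquareIntegrable x P) (hz : 0 < z.im) {s : ℂ} (hs : 1 + z * s + s ^ 2 = 0)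
    (hsi : 0 < s.im) :
    Tendsto (fun n => ∫ ω, stieltjes n (fun q => x q ω) z ∂P) atTop (𝓝 s) := by
  have hpos : ∀ n : ℕ, 0 < n → 0 < (∫ ω, stieltjes n (fun q => x q ω) z ∂P).im := by
    intro n hn
    have e : ∫ ω, (stieltjes n (fun q => x q ω) z).im ∂P =
        (∫ ω, stieltjes n (fun q => x q ω) z ∂P).im := integral_im (h.integrable_stieltjes hn hz)
    rw [← e, integral_pos_iff_support_of_nonneg (fun ω => (im_stieltjes_pos hn hz _).le)
      (h.integrable_stieltjes hn hz).im]
    have : Function.support (fun ω => (stieltjes n (fun q => x q ω) z).im) = Set.univ :=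
      Set.eq_univ_of_forall fun ω => (im_stieltjes_pos hn hz _).ne'
    rw [this]
    simp
  refine tendsto_of_tendsto_quadratic hs hsi
    ((eventually_gt_atTop 0).mono fun n hn => hpos n hn) ?_
  -- The equation for the mean differs from the mean of the equation by a variance.
  have hb : ∀ n : ℕ, 0 < n → ∀ φ : ℝ,
      (∀ p, ∫ ω, x p ω ^ 2 * min 1 (|x p ω| * (Real.sqrt n * z.im)⁻¹) ∂P ≤ φ) →
      ‖1 + z * ∫ ω, stieltjes n (fun q => x q ω) z ∂P +
        (∫ ω, stieltjes n (fun q => x q ω) z ∂P) ^ 2‖ ≤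
      4 * z.im⁻¹ ^ 2 * φ + 8 * z.im⁻¹ ^ 3 * (Real.sqrt n)⁻¹ + z.im⁻¹ ^ 2 * (n : ℝ)⁻¹ +
        8 * z.im⁻¹ ^ 4 * (n : ℝ)⁻¹ := by
    intro n hn φ hφ
    have h1 := h.norm_integral_stieltjes_equation_le hn hz hφ
    have h2 := h.integral_norm_stieltjes_sub_sq_le hn hz
    have hi := h.integrable_stieltjes hn hz
    set m := ∫ ω, stieltjes n (fun q => x q ω) z ∂P with hm
    have hi2 : Integrable (fun ω => (stieltjes n (fun q => x q ω) z - m) ^ 2) P := by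
      refine (h.integrable_norm_stieltjes_sub_sq hn hz m).mono' ?_ (ae_of_all _ fun ω => by simp)
      exact ((((continuous_stieltjes hn hz).sub continuous_const).pow 2).measurable.comp
        (measurable_family h)).aestronglyMeasurable
    have hi3 : Integrable (fun ω => (1 - m ^ 2) + (z + 2 * m) * stieltjes n (fun q => x q ω) z) P :=
      (integrable_const _).add (hi.const_mul _)
    have e : ∫ ω, (1 + z * stieltjes n (fun q => x q ω) z + stieltjes n (fun q => x q ω) z ^ 2) ∂P =
        (1 + z * m + m ^ 2) + ∫ ω, (stieltjes n (fun q => x q ω) z - m) ^ 2 ∂P := by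
      have e1 : ∀ c : ℂ, 1 + z * c + c ^ 2 = ((1 - m ^ 2) + (z + 2 * m) * c) + (c - m) ^ 2 :=
        fun c => by ring
      simp only [e1]
      rw [integral_add hi3 hi2, integral_add (integrable_const _) (hi.const_mul _),
        integral_const_mul, ← hm]
      simp
    have e2 : 1 + z * m + m ^ 2 = ∫ ω, (1 + z * stieltjes n (fun q => x q ω) z +
        stieltjes n (fun q => x q ω) z ^ 2) ∂P -
        ∫ ω, (stieltjes n (fun q => x q ω) z - m) ^ 2 ∂P := by
      rw [e]
      ring
    rw [e2]
    refine (norm_sub_le _ _).trans (add_le_add h1 ((norm_integral_le_integral_norm _).trans ?_))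
    simpa only [norm_pow] using h2
  rw [tendsto_zero_iff_norm_tendsto_zero, Metric.tendsto_nhds]
  intro ε hε
  set φ : ℝ := ε / (2 * (4 * z.im⁻¹ ^ 2)) with hφ
  have hφ0 : 0 < φ := by positivity
  have hφe : 4 * z.im⁻¹ ^ 2 * φ = ε / 2 := by
    rw [hφ]
    field_simp
  obtain ⟨K, hK⟩ := hu φ hφ0
  have hlim : Tendsto (fun n : ℕ => 8 * z.im⁻¹ ^ 3 * (Real.sqrt n)⁻¹ + z.im⁻¹ ^ 2 * (n : ℝ)⁻¹ +
      8 * z.im⁻¹ ^ 4 * (n : ℝ)⁻¹) atTop (𝓝 0) := by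
    have t1 := (tendsto_inv_atTop_zero.comp tendsto_sqrt_natCast).const_mul (8 * z.im⁻¹ ^ 3)
    have t2 := (tendsto_inv_atTop_zero.comp
      (tendsto_natCast_atTop_atTop (R := ℝ))).const_mul (z.im⁻¹ ^ 2)
    have t3 := (tendsto_inv_atTop_zero.comp
      (tendsto_natCast_atTop_atTop (R := ℝ))).const_mul (8 * z.im⁻¹ ^ 4)
    simpa using (t1.add t2).add t3
  filter_upwards [eventually_gt_atTop 0,
    (tendsto_sqrt_natCast.atTop_mul_const hz).eventually_ge_atTop K,
    hlim.eventually (gt_mem_nhds (half_pos hε))] with n hn hnK hnl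
  have hr : 0 < Real.sqrt n := Real.sqrt_pos.2 (by exact_mod_cast hn)
  have := hb n hn φ (hK _ hnK (by positivity))
  rw [dist_zero_right, norm_norm]
  rw [hφe] at this
  linarith

/-- Almost sure convergence: along the squares because the variances are summable, and then for all
sizes by interpolation. -/
lemma IndepStandardized.ae_tendsto_stieltjes (h : IndepStandardized x P)
    (hu : UniformlySquareIntegrable x P) (hz : 0 < z.im) {s : ℂ} (hs : 1 + z * s + s ^ 2 = 0)
    (hsi : 0 < s.im) :
    ∀ᵐ ω ∂P, Tendsto (fun n => stieltjes n (fun q => x q ω) z) atTop (𝓝 s) := by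
  set m : ℕ → ℂ := fun n => ∫ ω, stieltjes n (fun q => x q ω) z ∂P
  have hm : Tendsto m atTop (𝓝 s) := h.tendsto_integral_stieltjes hu hz hs hsi
  have hsq : Tendsto (fun k : ℕ => (k + 1) ^ 2) atTop atTop :=
    tendsto_atTop_mono (fun k => show k ≤ (k + 1) ^ 2 by nlinarith) tendsto_id
  have hpos : ∀ k : ℕ, 0 < (k + 1) ^ 2 := fun k => by positivity
  have hae := ae_tendsto_zero_of_summable_integral (P := P)
    (f := fun k ω => ‖stieltjes ((k + 1) ^ 2) (fun q => x q ω) z - m ((k + 1) ^ 2)‖ ^ 2)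
    (fun k => h.integrable_norm_stieltjes_sub_sq (hpos k) hz _) (fun k ω => sq_nonneg _) <| by
      refine Summable.of_nonneg_of_le (fun k => integral_nonneg fun ω => sq_nonneg _)
        (fun k => h.integral_norm_stieltjes_sub_sq_le (hpos k) hz) (Summable.mul_left _ ?_)
      have := (summable_nat_add_iff 1).2 (Real.summable_nat_pow_inv.2 one_lt_two)
      simpa using this
  filter_upwards [hae] with ω hω
  have h1 : Tendsto (fun k : ℕ => stieltjes ((k + 1) ^ 2) (fun q => x q ω) z) atTop (𝓝 s) := by
    have h2 : Tendsto (fun k : ℕ => ‖stieltjes ((k + 1) ^ 2) (fun q => x q ω) z -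
        m ((k + 1) ^ 2)‖) atTop (𝓝 0) := by
      have := (Real.continuous_sqrt.tendsto 0).comp hω
      simpa [Function.comp_def, Real.sqrt_sq (norm_nonneg _)] using this
    have h3 := (tendsto_zero_iff_norm_tendsto_zero.2 h2).add (hm.comp hsq)
    simpa [Function.comp_def] using h3
  have h4 : Tendsto (fun k : ℕ => stieltjes (k ^ 2) (fun q => x q ω) z) atTop (𝓝 s) :=
    (tendsto_add_atTop_iff_nat 1).1 h1
  have hsqrt : Tendsto Nat.sqrt atTop atTop :=
    tendsto_atTop.2 fun k => (eventually_ge_atTop (k ^ 2)).mono fun n hn => Nat.le_sqrt'.2 hn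
  have h5 : Tendsto (fun n : ℕ => (‖z‖ * z.im⁻¹ ^ 2 + 3 * z.im⁻¹) * ((Nat.sqrt n : ℕ) : ℝ)⁻¹)
      atTop (𝓝 0) := by
    have := (tendsto_inv_atTop_zero.comp
      ((tendsto_natCast_atTop_atTop (R := ℝ)).comp hsqrt)).const_mul
        (‖z‖ * z.im⁻¹ ^ 2 + 3 * z.im⁻¹)
    rwa [mul_zero] at this
  have h6 : Tendsto (fun n : ℕ => stieltjes n (fun q => x q ω) z -
      stieltjes (Nat.sqrt n ^ 2) (fun q => x q ω) z) atTop (𝓝 0) := by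
    refine squeeze_zero_norm' ?_ h5
    filter_upwards [eventually_gt_atTop 0] with n hn
    exact norm_stieltjes_sub_le (Nat.sqrt_pos.2 hn) (Nat.sqrt_le' n) (Nat.lt_succ_sqrt' n) hz _
  simpa using h6.add (h4.comp hsqrt)

end AlmostSure

/-! ### The empirical spectral distribution -/

section Spectral

variable {n : ℕ}

/-- The probability measure with mass `1/n` at `n^{-1/2} λ`, for each eigenvalue `λ` of `i W̃ₙ`
counted with multiplicity. -/
def spectralMeasure (n : ℕ) (y : InputIndex → ℝ) : Measure ℝ :=
  (n : ENNReal)⁻¹ • ∑ i, Measure.dirac ((Real.sqrt n)⁻¹ * (isHermitian_herm n y).eigenvalues i)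

lemma isProbabilityMeasure_spectralMeasure (hn : 0 < n) (y : InputIndex → ℝ) :
    IsProbabilityMeasure (spectralMeasure n y) := by
  refine ⟨?_⟩
  rw [spectralMeasure, Measure.smul_apply, Measure.finsetSum_apply]
  simp only [measure_univ, Finset.sum_const, Finset.card_univ, Fintype.card_fin, nsmul_eq_mul,
    mul_one, smul_eq_mul]
  exact ENNReal.inv_mul_cancel (by exact_mod_cast hn.ne') (ENNReal.natCast_ne_top n)

lemma integral_spectralMeasure_inv_sub (hn : 0 < n) (y : InputIndex → ℝ) {z : ℂ}
    (hz : 0 < z.im) :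
    ∫ t : ℝ, ((t : ℂ) - z)⁻¹ ∂spectralMeasure n y = stieltjes n y z := by
  have hr : 0 < Real.sqrt n := Real.sqrt_pos.2 (by exact_mod_cast hn)
  have hr' : (Real.sqrt n : ℂ) ≠ 0 := by exact_mod_cast hr.ne'
  have hrr : (n : ℂ) = (Real.sqrt n : ℂ) ^ 2 := by
    rw [← Complex.ofReal_pow, Real.sq_sqrt (by positivity), Complex.ofReal_natCast]
  rw [spectralMeasure, integral_smul_measure, integral_finsetSum_measure fun i _ =>
    integrable_inv_sub _ hz, stieltjes, trace_res (isHermitian_herm n y) (im_sqrt_mul_pos hn hz)]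
  simp only [integral_dirac, ENNReal.toReal_inv, ENNReal.toReal_natCast, Complex.real_smul,
    Finset.mul_sum]
  refine Finset.sum_congr rfl fun i _ => ?_
  have h1 : ((isHermitian_herm n y).eigenvalues i : ℂ) - Real.sqrt n * z =
      Real.sqrt n * ((((Real.sqrt n)⁻¹ * (isHermitian_herm n y).eigenvalues i : ℝ) : ℂ) - z) := by
    push_cast
    field_simp
  rw [h1, mul_inv]
  push_cast
  rw [hrr]
  field_simp

lemma map_smul_skewWigner (y : InputIndex → ℝ) :
    ((Real.sqrt n)⁻¹ • skewWigner (fun p (y : InputIndex → ℝ) => y p) n y).map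
      (fun r : ℝ => (r : ℂ)) = (-Complex.I * (Real.sqrt n : ℂ)⁻¹) • herm n y := by
  ext i j
  simp only [Matrix.map_apply, Matrix.smul_apply, skewWigner, Matrix.hadamard_apply, wigner,
    signMatrix_apply, Matrix.of_apply, herm_apply, smul_eq_mul]
  push_cast
  linear_combination ((Real.sqrt n : ℂ)⁻¹ * (sgn i j * y (wignerLink i j))) * Complex.I_mul_I

/-- The eigenvalues of a multiple of a Hermitian matrix. -/
lemma roots_charpoly_smul {ι : Type*} [Fintype ι] [DecidableEq ι] {H : Matrix ι ι ℂ}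
    (hH : H.IsHermitian) (c : ℂ) :
    (c • H).charpoly.roots = Finset.univ.val.map fun i => c * (hH.eigenvalues i : ℂ) := by
  have h : (c • H).charpoly =
      (Finset.univ.val.map fun i => Polynomial.X - Polynomial.C (c * (hH.eigenvalues i : ℂ))).prod
      := by
    conv_lhs => rw [hH.spectral_theorem, Unitary.conjStarAlgAut_apply, ← smul_mul_assoc,
      ← mul_smul_comm, Matrix.charpoly_mul_comm, ← mul_assoc]
    rw [Unitary.coe_star_mul_self, one_mul, ← Matrix.diagonal_smul, Matrix.charpoly_diagonal]
    rfl
  have h2 := Polynomial.roots_multiset_prod_X_sub_C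
    (Finset.univ.val.map fun i => c * (hH.eigenvalues i : ℂ))
  rw [Multiset.map_map] at h2
  rw [h]
  exact h2

lemma esd_eq_spectralMeasure_real (y : InputIndex → ℝ) (t : ℝ) :
    esd ((Real.sqrt n)⁻¹ • skewWigner (fun p (y : InputIndex → ℝ) => y p) n y) t =
      (spectralMeasure n y).real (Set.Iic t) := by
  have h1 : ∀ l : ℝ, (Complex.I * (-Complex.I * (Real.sqrt n : ℂ)⁻¹ * (l : ℂ))).re =
      (Real.sqrt n)⁻¹ * l := by
    intro l
    have : Complex.I * (-Complex.I * (Real.sqrt n : ℂ)⁻¹ * (l : ℂ)) =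
        (((Real.sqrt n)⁻¹ * l : ℝ) : ℂ) := by
      push_cast
      linear_combination (-(Real.sqrt n : ℂ)⁻¹ * l) * Complex.I_mul_I
    rw [this, Complex.ofReal_re]
  rw [esd, eigenvalues, map_smul_skewWigner, roots_charpoly_smul (isHermitian_herm n y),
    Multiset.countP_map]
  simp only [h1]
  rw [spectralMeasure, Measure.real, Measure.smul_apply, Measure.finsetSum_apply]
  simp only [Measure.dirac_apply' _ measurableSet_Iic, Set.indicator_apply, Set.mem_Iic,
    Pi.one_apply, Finset.sum_boole, smul_eq_mul, ENNReal.toReal_mul, ENNReal.toReal_inv,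
    ENNReal.toReal_natCast, one_div]
  rfl

end Spectral

lemma norm_stieltjes_transform_sub_le (μ : Measure ℝ) [IsProbabilityMeasure μ] {z w : ℂ}
    (hz : 0 < z.im) (hw : 0 < w.im) :
    ‖∫ t : ℝ, ((t : ℂ) - z)⁻¹ ∂μ - ∫ t : ℝ, ((t : ℂ) - w)⁻¹ ∂μ‖ ≤
      ‖z - w‖ * (z.im⁻¹ * w.im⁻¹) := by
  rw [← integral_sub (integrable_inv_sub μ hz) (integrable_inv_sub μ hw)]
  have h : ∀ t : ℝ, ‖((t : ℂ) - z)⁻¹ - ((t : ℂ) - w)⁻¹‖ ≤ ‖z - w‖ * (z.im⁻¹ * w.im⁻¹) := by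
    intro t
    have h1 := sub_ne_zero_of_im_pos t hz
    have h2 := sub_ne_zero_of_im_pos t hw
    have e : ((t : ℂ) - z)⁻¹ - ((t : ℂ) - w)⁻¹ =
        (z - w) * (((t : ℂ) - z)⁻¹ * ((t : ℂ) - w)⁻¹) := by
      field_simp
      ring
    rw [e, norm_mul, norm_mul]
    exact mul_le_mul_of_nonneg_left (mul_le_mul (norm_inv_sub_le t hz) (norm_inv_sub_le t hw)
      (norm_nonneg _) (by positivity)) (norm_nonneg _)
  simpa using norm_integral_le_of_norm_le_const (μ := μ) (ae_of_all _ h)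

/-- Stieltjes transforms are locally Lipschitz uniformly in the measure, so that it suffices to
check their convergence on a dense set. -/
lemma tendsto_stieltjes_transform_of_dense {μ : ℕ → Measure ℝ} [∀ n, IsProbabilityMeasure (μ n)]
    {ν : Measure ℝ} [IsProbabilityMeasure ν] {D : Set ℂ} (hD : Dense D)
    (h : ∀ z ∈ D, 0 < z.im → Tendsto (fun n => ∫ t : ℝ, ((t : ℂ) - z)⁻¹ ∂μ n) atTop
      (𝓝 (∫ t : ℝ, ((t : ℂ) - z)⁻¹ ∂ν))) {z : ℂ} (hz : 0 < z.im) :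
    Tendsto (fun n => ∫ t : ℝ, ((t : ℂ) - z)⁻¹ ∂μ n) atTop
      (𝓝 (∫ t : ℝ, ((t : ℂ) - z)⁻¹ ∂ν)) := by
  rw [Metric.tendsto_nhds]
  intro ε hε
  set L : ℝ := z.im⁻¹ * (z.im / 2)⁻¹ with hL
  have hL0 : 0 < L := by positivity
  obtain ⟨w, hwD, hw⟩ := hD.exists_dist_lt z (lt_min (half_pos hz) (div_pos hε (by positivity :
    0 < 3 * L)))
  rw [dist_eq_norm] at hw
  have hw1 : z.im / 2 ≤ w.im := by
    have h1 := (le_abs_self _).trans (Complex.abs_im_le_norm (z - w))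
    rw [Complex.sub_im] at h1
    linarith [hw.trans_le (min_le_left _ _)]
  have hwi : 0 < w.im := (half_pos hz).trans_le hw1
  have hlip : ∀ (ρ : Measure ℝ) [IsProbabilityMeasure ρ],
      ‖∫ t : ℝ, ((t : ℂ) - z)⁻¹ ∂ρ - ∫ t : ℝ, ((t : ℂ) - w)⁻¹ ∂ρ‖ < ε / 3 := by
    intro ρ _
    refine (norm_stieltjes_transform_sub_le ρ hz hwi).trans_lt ?_
    have h2 : z.im⁻¹ * w.im⁻¹ ≤ L :=
      mul_le_mul_of_nonneg_left (inv_anti₀ (half_pos hz) hw1) (by positivity)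
    have h3 := hw.trans_le (min_le_right _ _)
    rw [lt_div_iff₀ (by positivity)] at h3
    nlinarith [norm_nonneg (z - w)]
  filter_upwards [Metric.tendsto_nhds.1 (h w hwD hwi) (ε / 3) (by positivity)] with n hn
  have a1 := hlip (μ n)
  have a2 := hlip ν
  rw [← dist_eq_norm] at a1 a2
  rw [dist_comm] at a2
  linarith [dist_triangle4 (∫ t : ℝ, ((t : ℂ) - z)⁻¹ ∂μ n) (∫ t : ℝ, ((t : ℂ) - w)⁻¹ ∂μ n)
    (∫ t : ℝ, ((t : ℂ) - w)⁻¹ ∂ν) (∫ t : ℝ, ((t : ℂ) - z)⁻¹ ∂ν)]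

lemma semicircleLaw_singleton (t : ℝ) : semicircleLaw {t} = 0 :=
  withDensity_absolutelyContinuous _ _ (measure_singleton t)

/-- The semicircle law for independent standardized variables whose squares are uniformly
integrable. -/
lemma convergesWeaklyAS_esd {Ω : Type*} [MeasurableSpace Ω] {P : Measure Ω}
    [IsProbabilityMeasure P] {x : InputIndex → Ω → ℝ} (h : IndepStandardized x P)
    (hu : UniformlySquareIntegrable x P) :
    ConvergesWeaklyAS P (fun n ω => esd ((Real.sqrt (n : ℝ))⁻¹ • skewWigner x n ω))
      (fun t => semicircleLaw.real (Set.Iic t)) := by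
  obtain ⟨D, hDc, hDd⟩ := TopologicalSpace.exists_countable_dense ℂ
  have hae : ∀ᵐ ω ∂P, ∀ z ∈ D, 0 < z.im → Tendsto
      (fun n => stieltjes n (fun q => x q ω) z) atTop
      (𝓝 (∫ t : ℝ, ((t : ℂ) - z)⁻¹ ∂semicircleLaw)) := by
    rw [ae_ball_iff hDc]
    intro z _
    by_cases hz : 0 < z.im
    · obtain ⟨s, hs, hsi⟩ := exists_root_im_pos hz
      rw [integral_semicircleLaw_inv_sub hz hs hsi]
      filter_upwards [h.ae_tendsto_stieltjes hu hz hs hsi] with ω hω _ using hω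
    · exact ae_of_all _ fun ω h0 => absurd h0 hz
  filter_upwards [hae] with ω hω t _
  rw [← tendsto_add_atTop_iff_nat 1]
  have hp : ∀ n, IsProbabilityMeasure (spectralMeasure (n + 1) fun q => x q ω) := fun n =>
    isProbabilityMeasure_spectralMeasure n.succ_pos _
  have hst : ∀ z ∈ D, 0 < z.im → Tendsto
      (fun n => ∫ t : ℝ, ((t : ℂ) - z)⁻¹ ∂spectralMeasure (n + 1) fun q => x q ω) atTop
      (𝓝 (∫ t : ℝ, ((t : ℂ) - z)⁻¹ ∂semicircleLaw)) := by
    intro z hzD hz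
    simp only [integral_spectralMeasure_inv_sub (Nat.succ_pos _) _ hz]
    exact (tendsto_add_atTop_iff_nat 1).2 (hω z hzD hz)
  have key := tendsto_real_Iic_of_stieltjes
    (fun z hz => tendsto_stieltjes_transform_of_dense hDd hst hz) (semicircleLaw_singleton t)
  refine key.congr fun n => ?_
  exact (esd_eq_spectralMeasure_real (n := n + 1) (fun q => x q ω) t).symm

end SkewWigner

end

theorem mainTheorem1 {Ω : Type*} [MeasurableSpace Ω] (P : Measure Ω) [IsProbabilityMeasure P]
    (x : SkewWigner.InputIndex → Ω → ℝ)
    (hx : SkewWigner.AssumptionA1 x P ∨ SkewWigner.AssumptionA2 x P ∨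
      SkewWigner.AssumptionA3 x P) :
    SkewWigner.ConvergesWeaklyAS P
      (fun n ω => SkewWigner.esd ((Real.sqrt (n : ℝ))⁻¹ • SkewWigner.skewWigner x n ω))
      (fun t => SkewWigner.semicircleLaw.real (Set.Iic t)) ∧
    ∀ (k n : ℕ) (w : Fin (2 * k) → ℕ), SkewWigner.IsCatalan (List.ofFn w) →
      ∀ π : Fin (2 * k + 1) → Fin n, SkewWigner.MatchesWord w π →
        (SkewWigner.Loopless π → SkewWigner.circuitSign π = (-1) ^ k) ∧
        (¬ SkewWigner.Loopless π → SkewWigner.circuitSign π = 0) := by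
  refine ⟨?_, fun k n w hw π hπ => ⟨SkewWigner.circuitSign_of_loopless hw hπ,
    SkewWigner.circuitSign_of_not_loopless⟩⟩
  rcases hx with h | h | h
  · exact SkewWigner.convergesWeaklyAS_esd h.1 h.uniformlySquareIntegrable
  · exact SkewWigner.convergesWeaklyAS_esd h.1 h.uniformlySquareIntegrable
  · exact SkewWigner.convergesWeaklyAS_esd h.1 h.uniformlySquareIntegrable
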